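/- Let $f=(f_1,\dots,f_s)$ be polynomials in $\mathbb{C}[\mathbf z]=\mathbb{C}[z_1,\dots,z_n]$ generating a prime ideal $I_X$, let $X=V(I_X)\subseteq\mathbb{C}^n$ and let $c=\operatorname{codim}X$. Write $J(f)$ for the $s\times n$ Jacobian matrix of $f$, $\langle\mathbf a,\mathbf b\rangle=\sum_i a_ib_i$ for the standard bilinear form, and $I_{X_{\rm sing}}=I_X+\langle c\text{-minors of }J(f)\rangle$, $X_{\rm reg}=X\setminus V(I_{X_{\rm sing}})$. On $\mathbb{C}[\mathbf z,\mathbf w,\mathbf u,\mathbf v]$ (four sets of $n$ variables) let $*$ be the ring map that exchanges $z_k\leftrightarrow w_k$, $u_k\leftrightarrow v_k$ and conjugates the coefficients; for an ideal $I$ let $I^*$ be its image. Let $I'_X$ be the ideal of the $(c+1)$-minors of the matrix with first row $\mathbf v-\mathbf w$ followed by the rows of $J_{\mathbf z}(f)$. The Hermitian critical ideal of $X$ is $$\left(I_X+I_X^{*}+I'_X+(I'_X)^{*}\right):\left(I_{X_{\rm sing}}\cdot I_{X_{\rm sing}}^{*}\right)^{\infty}\subseteq\mathbb{C}[\mathbf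 z,\mathbf w,\mathbf u,\mathbf v].$$ A virtual Hermitian distance polynomial of $X$ is a polynomial $\mathrm{vHDp}_{X,\mathbf u,\mathbf v}(T)\in\mathbb{C}[\mathbf u,\mathbf v][T]$ such that $\mathrm{vHDp}_{X,\mathbf u,\mathbf v}(t^2)$ generates the intersection with $\mathbb{C}[\mathbf u,\mathbf v,t]$ of the ideal of $\mathbb{C}[\mathbf z,\mathbf w,\mathbf u,\mathbf v,t]$ generated by the Hermitian critical ideal of $X$ and by $t^2-\langle\mathbf u-\mathbf z,\mathbf v-\mathbf w\rangle$; it is unique up to a nonzero scalar if it exists. The dual variety of $X$ is the Zariski closure $$X^\vee=\overline{\{\mathbf s\in\mathbb{C}^n:\ \exists\,\mathbf z\in X_{\rm reg},\ \langle\mathbf s,\mathbf x\rangle=0\text{ for all }\mathbf x\in T_{\mathbf z}X\}},\qquad T_{\mathbf z}X=\ker J(f)(\mathbf z).$$ **Theorem.** Suppose that $X$ is an (irreducible) affine cone, i.e. $a\mathbf z\in X$ for all $a\in\mathbb{C}$ and $\mathbf z\in X$. Let $g_1,\dots,g_r$ be any generators of the ideal of polynomials vanishing on $X^\vee$, and define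 the objects attached to $X^\vee$ with $g$. Then nonzero virtual Hermitian distance polynomials of $X$ and of $X^\vee$ exist, and any such polynomials satisfy, up to a nonzero constant factor in $\mathbb{C}$, $$\mathrm{vHDp}_{X,\mathbf u,\mathbf v}(t^2)=\mathrm{vHDp}_{X^\vee,\mathbf v,\mathbf u}\left(\langle\mathbf u,\mathbf v\rangle-t^2\right)$$ as polynomials in $\mathbf u,\mathbf v,t$, where $\mathrm{vHDp}_{X^\vee,\mathbf v,\mathbf u}$ is obtained from $\mathrm{vHDp}_{X^\vee,\mathbf u,\mathbf v}$ by exchanging $\mathbf u$ and $\mathbf v$. -/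

import Mathlib

namespace HermitianDistance

noncomputable section

/-- The ideal generated by all `k × k` minors of `M`. (Arbitrary `k`-tuples of rows and columns are
used; repetitions give `0` and reorderings only change the sign, so this is the usual ideal.) -/
def minorsIdeal {R ρ κ : Type*} [CommRing R] (k : ℕ) (M : Matrix ρ κ R) : Ideal R :=
  Ideal.span {d | ∃ (a : Fin k → ρ) (b : Fin k → κ), d = (M.submatrix a b).det}

/-- The saturation `J : K^∞ = {p | ∃ m, p · K^m ⊆ J}`. -/
def saturation {R : Type*} [CommRing R] (J K : Ideal R) : Ideal R where
  carrier := {p | ∃ m : ℕ, ∀ q ∈ K ^ m, p * q ∈ J}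
  zero_mem' := ⟨0, fun q _ => by simp⟩
  add_mem' := by
    rintro a b ⟨m, hm⟩ ⟨k, hk⟩
    refine ⟨max m k, fun q hq => ?_⟩
    rw [add_mul]
    exact J.add_mem (hm q (Ideal.pow_le_pow_right (le_max_left m k) hq))
      (hk q (Ideal.pow_le_pow_right (le_max_right m k) hq))
  smul_mem' := by
    rintro c a ⟨m, hm⟩
    refine ⟨m, fun q hq => ?_⟩
    rw [smul_eq_mul, mul_assoc]
    exact J.mul_mem_left c (hm q hq)

/-! ### Affine varieties given by generators `f` of their ideal -/

section Variety

variable {n s : ℕ} (f : Fin s → MvPolynomial (Fin n) ℂ)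

/-- The ideal `⟨f₁, …, f_s⟩ ⊆ ℂ[z₁, …, z_n]`. -/
def ideal : Ideal (MvPolynomial (Fin n) ℂ) := Ideal.span (Set.range f)

/-- The variety `X = V(f₁, …, f_s) ⊆ ℂⁿ`. -/
def variety : Set (Fin n → ℂ) := MvPolynomial.zeroLocus ℂ (ideal f)

/-- The codimension `n - dim X`, where `dim X` is the transcendence degree over `ℂ` of the
coordinate ring `ℂ[z] / ⟨f₁, …, f_s⟩`. -/
def codim : ℕ := n - (Algebra.trdeg ℂ (MvPolynomial (Fin n) ℂ ⧸ ideal f)).toNat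

/-- The `s × n` Jacobian matrix of `f`. -/
def jacobian : Matrix (Fin s) (Fin n) (MvPolynomial (Fin n) ℂ) :=
  Matrix.of fun i j => MvPolynomial.pderiv j (f i)

/-- The ideal of the singular locus: the ideal of `X` plus the `c`-minors of the Jacobian. -/
def singIdeal : Ideal (MvPolynomial (Fin n) ℂ) := ideal f ⊔ minorsIdeal (codim f) (jacobian f)

/-- The regular locus of `X`. -/
def regularLocus : Set (Fin n → ℂ) := variety f \ MvPolynomial.zeroLocus ℂ (singIdeal f)

/-- The tangent space of `X` at `z`: the kernel of the Jacobian matrix evaluated at `z`. -/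
def tangentSpace (z : Fin n → ℂ) : Submodule ℂ (Fin n → ℂ) :=
  LinearMap.ker ((jacobian f).map (MvPolynomial.eval z)).mulVecLin

/-- The dual variety: the Zariski closure of the set of vectors orthogonal, with respect to the
bilinear form `⟨y, x⟩ = ∑ yᵢ xᵢ`, to the tangent space at some regular point of `X`. -/
def dualVariety : Set (Fin n → ℂ) :=
  MvPolynomial.zeroLocus ℂ (MvPolynomial.vanishingIdeal ℂ
    {y : Fin n → ℂ | ∃ z ∈ regularLocus f, ∀ x ∈ tangentSpace f z, y ⬝ᵥ x = 0})

end Variety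

/-! ### The Hermitian critical ideal -/

/-- The variables of `ℂ[z, w, u, v]`; `w` and `v` stand for the conjugates of `z` and `u`. -/
inductive HVar (n : ℕ) : Type
  | z (i : Fin n) : HVar n
  | w (i : Fin n) : HVar n
  | u (i : Fin n) : HVar n
  | v (i : Fin n) : HVar n

/-- The exchange `z ↔ w`, `u ↔ v` of variables. -/
def HVar.conj {n : ℕ} : HVar n → HVar n
  | .z i => .w i
  | .w i => .z i
  | .u i => .v i
  | .v i => .u i

/-- The polynomial ring `ℂ[z, w, u, v]`. -/
abbrev HRing (n : ℕ) : Type := MvPolynomial (HVar n) ℂ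

/-- The map `*` on `ℂ[z, w, u, v]`: it exchanges `z ↔ w`, `u ↔ v` and conjugates coefficients. -/
def starMap (n : ℕ) : HRing n →+* HRing n :=
  ((MvPolynomial.rename HVar.conj : HRing n →ₐ[ℂ] HRing n) : HRing n →+* HRing n).comp
    (MvPolynomial.map (starRingEnd ℂ))

/-- The inclusion `ℂ[z] → ℂ[z, w, u, v]`. -/
def inclZ (n : ℕ) : MvPolynomial (Fin n) ℂ →+* HRing n :=
  ((MvPolynomial.rename HVar.z : MvPolynomial (Fin n) ℂ →ₐ[ℂ] HRing n) :
    MvPolynomial (Fin n) ℂ →+* HRing n)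

section Critical

variable {n s : ℕ} (f : Fin s → MvPolynomial (Fin n) ℂ)

/-- The `(s+1) × n` matrix with first row `v - w`, followed by the Jacobian `J_z(f)`. -/
def augmentedMatrix : Matrix (Fin (s + 1)) (Fin n) (HRing n) :=
  Matrix.of (Fin.cons
    (fun j => MvPolynomial.X (HVar.v j) - MvPolynomial.X (HVar.w j))
    (fun i j => inclZ n (jacobian f i j)))

/-- The ideal `I'_X` of the `(c+1)`-minors of the augmented matrix. -/
def conormalIdeal : Ideal (HRing n) := minorsIdeal (codim f + 1) (augmentedMatrix f)

/-- The Hermitian critical ideal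
`(I_X + I_X* + I'_X + I'_X*) : (I_{X_sing} · I_{X_sing}*)^∞ ⊆ ℂ[z, w, u, v]`. -/
def criticalIdeal : Ideal (HRing n) :=
  saturation
    ((ideal f).map (inclZ n) ⊔ ((ideal f).map (inclZ n)).map (starMap n)
      ⊔ conormalIdeal f ⊔ (conormalIdeal f).map (starMap n))
    ((singIdeal f).map (inclZ n) * ((singIdeal f).map (inclZ n)).map (starMap n))

end Critical

/-! ### The virtual Hermitian distance polynomial -/

/-- The polynomial ring `ℂ[u, v]`; `Sum.inl i` is the variable `uᵢ`, `Sum.inr i` is `vᵢ`. -/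
abbrev PRing (n : ℕ) : Type := MvPolynomial (Fin n ⊕ Fin n) ℂ

/-- The inclusion `ℂ[u, v] → ℂ[z, w, u, v]`. -/
def inclUV (n : ℕ) : PRing n →+* HRing n :=
  ((MvPolynomial.rename (Sum.elim HVar.u HVar.v) : PRing n →ₐ[ℂ] HRing n) : PRing n →+* HRing n)

/-- The polynomial `⟨u - z, v - w⟩ = ∑ (uᵢ - zᵢ)(vᵢ - wᵢ)`. -/
def distPoly (n : ℕ) : HRing n :=
  ∑ i : Fin n, (MvPolynomial.X (HVar.u i) - MvPolynomial.X (HVar.z i)) *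
    (MvPolynomial.X (HVar.v i) - MvPolynomial.X (HVar.w i))

/-- The polynomial `⟨u, v⟩ = ∑ uᵢ vᵢ`. -/
def pairing (n : ℕ) : PRing n :=
  ∑ i : Fin n, MvPolynomial.X (Sum.inl i) * MvPolynomial.X (Sum.inr i)

/-- The exchange `u ↔ v` of variables in `ℂ[u, v]`. -/
def swapUV (n : ℕ) : PRing n →+* PRing n :=
  ((MvPolynomial.rename Sum.swap : PRing n →ₐ[ℂ] PRing n) : PRing n →+* PRing n)

/-- The intersection with `ℂ[u, v][t]` of the sum, in `ℂ[z, w, u, v][t]`, of the Hermitian critical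
ideal and the ideal `⟨t² - ⟨u - z, v - w⟩⟩`. -/
def eliminationIdeal {n s : ℕ} (f : Fin s → MvPolynomial (Fin n) ℂ) :
    Ideal (Polynomial (PRing n)) :=
  ((criticalIdeal f).map (Polynomial.C : HRing n →+* Polynomial (HRing n))
    ⊔ Ideal.span {Polynomial.X ^ 2 - Polynomial.C (distPoly n)}).comap
      (Polynomial.mapRingHom (inclUV n))

/-- `P(T) ∈ ℂ[u, v][T]` is a virtual Hermitian distance polynomial of `X = V(f)`: the elimination
ideal is generated by `P(t²)`. -/
def IsVHDPolynomial {n s : ℕ} (f : Fin s → MvPolynomial (Fin n) ℂ)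
    (P : Polynomial (PRing n)) : Prop :=
  eliminationIdeal f = Ideal.span {P.comp (Polynomial.X ^ 2)}

end

end HermitianDistance

/-! Everything is read off from the conormal variety `N_X`, the closure of the set of pairs `(z, y)`
with `z` in `X` and `y` in the row space of `J(f)(z)`. It is the image of `X × ℂ^s` under `(z, ℓ) ↦
(z, ℓ J(z))`, hence irreducible, and it has dimension `n`.

Put `u = z + x` and `v = w + y`. Away from the singular loci the critical equations say that `(z,
y)` is a conormal pair of `X` and `(w, x)` one of the conjugate variety. The saturation removes
exactly the rest, so the Hermitian critical ideal is the prime ideal of `N_X × N_{X̄}`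
(`criticalIdeal_eq`), and the squared distance becomes `⟨x, y⟩`.

Existence: splitting polynomials in `t` into even and odd parts reduces the elimination ideal to
`distanceIdeal`, the prime ideal of those `A(T)` over `ℂ[u, v]` for which `A(⟨u - z, v - w⟩)` is in
the critical ideal (`isVHDPolynomial_iff`). This prime meets `ℂ[u, v]` in zero, because the map from
pairs of conormal vectors to `(u, v)` is dominant (`eq_zero_of_inclUV_mem_criticalIdeal`). Over a
factorial ring it is therefore principal. It is nonzero because `2n + 1` functions on a variety of
dimension `2n` are algebraically dependent.

Duality: for a cone, Euler's relation gives `⟨z, y⟩ = 0` on `N_X` and likewise `⟨w, x⟩ = 0`, so `⟨u,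
v⟩ = ⟨z + x, w + y⟩ = ⟨z, w⟩ + ⟨x, y⟩`. Biduality says that `N_{X^∨}` is `N_X` with its two factors
exchanged (`conormalVanishing_dual`). The exchange turns `(u, v)` into `(v, u)` and the squared
distance `⟨x, y⟩` into `⟨w, z⟩ = ⟨u, v⟩ - ⟨x, y⟩`. So `T ↦ ⟨u, v⟩ - T` together with `u ↔ v` carries
one distance ideal to the other (`dualSubst_mem_distanceIdeal`), and generators correspond up to a
unit, that is, a nonzero constant. -/

namespace HermitianDistance

open MvPolynomial

/-! ### Linear algebra: minors, rank and Cramer's rule. -/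

section LinearAlgebra

theorem exists_linearIndependent_rows {K ρ κ : Type*} [Field K] [Fintype ρ] [Fintype κ]
    (M : Matrix ρ κ K) : ∃ a : Fin M.rank → ρ, LinearIndependent K fun i => M.row (a i) := by
  have h : Module.finrank K (Submodule.span K (Set.range M.row)) = M.rank :=
    (Matrix.rank_eq_finrank_span_row M).symm
  obtain ⟨v, hv, -, hli⟩ := Submodule.exists_fun_fin_finrank_span_eq K (Set.range M.row)
  choose a ha using hv
  refine ⟨fun i => a (Fin.cast h.symm i), ?_⟩
  simp only [ha]
  exact hli.comp _ (Fin.cast_injective _)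

theorem exists_minor_ne_zero {K ρ κ : Type*} [Field K] [Fintype ρ] [Fintype κ]
    {M : Matrix ρ κ K} {c : ℕ} (hM : M.rank = c) :
    ∃ (a : Fin c → ρ) (b : Fin c → κ), (M.submatrix a b).det ≠ 0 := by
  subst hM
  obtain ⟨a, ha⟩ := exists_linearIndependent_rows M
  have hr : (M.submatrix a id).transpose.rank = M.rank := by
    rw [Matrix.rank_transpose]
    have := ha.rank_matrix (M := M.submatrix a id)
    simpa using this
  obtain ⟨b, hb⟩ := exists_linearIndependent_rows (M.submatrix a id).transpose
  refine ⟨a, fun i => b (Fin.cast hr.symm i), ?_⟩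
  have h2 : LinearIndependent K ((M.submatrix a fun i => b (Fin.cast hr.symm i)).col) :=
    hb.comp _ (Fin.cast_injective _)
  rw [Matrix.linearIndependent_cols_iff_isUnit, Matrix.isUnit_iff_isUnit_det] at h2
  exact h2.ne_zero

theorem minor_eq_zero_of_rank_lt {K ρ κ : Type*} [Field K] [Fintype ρ] [Fintype κ]
    {M : Matrix ρ κ K} {k : ℕ} (hM : M.rank < k) (a : Fin k → ρ) (b : Fin k → κ) :
    (M.submatrix a b).det = 0 := by
  by_contra h
  have h1 : (M.submatrix a b).rank = k := by
    rw [Matrix.rank_of_isUnit _ ((Matrix.isUnit_iff_isUnit_det _).2 (isUnit_iff_ne_zero.2 h))]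
    simp
  have := Matrix.rank_submatrix_le M a b
  omega

/-- If a `c`-minor is invertible and the minors bordering it by the row `y` vanish, then `y` is a
combination of the rows of that minor. -/
theorem eq_vecMul_of_minors_eq_zero {S ρ κ : Type*} [CommRing S] {J : Matrix ρ κ S} {y : κ → S}
    {c : ℕ} {a : Fin c → ρ} {b : Fin c → κ} (hu : IsUnit (J.submatrix a b).det)
    (h : ∀ j, ((Matrix.of (Fin.cons y fun i => J (a i)) : Matrix (Fin (c + 1)) κ S).submatrix id
      (Fin.cons j b : Fin (c + 1) → κ)).det = 0) :
    y = Matrix.vecMul (Matrix.vecMul (y ∘ b) (J.submatrix a b)⁻¹) (J.submatrix a id) := by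
  funext j
  -- The reindexing moves the bordering row and column from position `0` to the end. The determinant
  -- is then `det N` times a `1 × 1` Schur complement, whose vanishing is the claim at `j`.
  let e : Fin c ⊕ Unit ≃ Fin (c + 1) :=
    (Equiv.optionEquivSumPUnit (Fin c)).symm.trans (finSuccEquiv c).symm
  have he : ∀ i, e (Sum.inl i) = i.succ := fun i => by simp [e]
  have he' : e (Sum.inr ()) = 0 := by simp [e]
  have hj := h j
  rw [← Matrix.det_submatrix_equiv_self e, ← Matrix.fromBlocks_toBlocks (Matrix.submatrix _ e e)]
    at hj
  let N : Matrix (Fin c) (Fin c) S := J.submatrix a b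
  let B : Matrix (Fin c) Unit S := Matrix.of fun i _ => J (a i) j
  let C : Matrix Unit (Fin c) S := Matrix.of fun _ i => y (b i)
  let D : Matrix Unit Unit S := Matrix.of fun _ _ => y j
  have hN := Matrix.invertibleOfIsUnitDet N hu
  have hbl : (Matrix.fromBlocks N B C D).det = 0 := by
    convert hj using 3 <;> ext x y' <;>
      simp [N, B, C, D, Matrix.toBlocks₁₁, Matrix.toBlocks₁₂, Matrix.toBlocks₂₁,
        Matrix.toBlocks₂₂, he, he']
  rw [Matrix.det_fromBlocks₁₁] at hbl
  have h0 : (D - C * ⅟N * B).det = 0 := (hu.mul_right_eq_zero).1 hbl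
  rw [Matrix.det_unique] at h0
  simp only [Matrix.invOf_eq_nonsing_inv] at h0
  simp only [Matrix.sub_apply, sub_eq_zero] at h0
  exact h0

end LinearAlgebra

end HermitianDistance

namespace HermitianDistance

open MvPolynomial

/-! ### Vanishing ideals of products of varieties. -/

section Product

variable {σ τ : Type*}

/-- The product of two sets of points, as a set of points in the disjoint union of the variables. -/
def prodSet (V : Set (σ → ℂ)) (W : Set (τ → ℂ)) : Set (σ ⊕ τ → ℂ) :=
  {x | x ∘ Sum.inl ∈ V ∧ x ∘ Sum.inr ∈ W}

theorem sumElim_mem_prodSet {V : Set (σ → ℂ)} {W : Set (τ → ℂ)} {x : σ → ℂ} {y : τ → ℂ}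
    (hx : x ∈ V) (hy : y ∈ W) : Sum.elim x y ∈ prodSet V W := by
  simpa [prodSet] using ⟨hx, hy⟩

/-- Specialisation of the first group of variables. -/
noncomputable def specLeft (x : σ → ℂ) : MvPolynomial (σ ⊕ τ) ℂ →ₐ[ℂ] MvPolynomial τ ℂ :=
  aeval (Sum.elim (fun i => C (x i)) X)

/-- Specialisation of the second group of variables. -/
noncomputable def specRight (y : τ → ℂ) : MvPolynomial (σ ⊕ τ) ℂ →ₐ[ℂ] MvPolynomial σ ℂ :=
  aeval (Sum.elim X (fun i => C (y i)))

theorem aeval_specLeft (x : σ → ℂ) (y : τ → ℂ) (p : MvPolynomial (σ ⊕ τ) ℂ) :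
    aeval y (specLeft x p) = aeval (Sum.elim x y) p := by
  have : (aeval y).comp (specLeft x) = aeval (R := ℂ) (Sum.elim x y) := by
    ext i
    cases i <;> simp [specLeft]
  exact DFunLike.congr_fun this p

theorem aeval_specRight (x : σ → ℂ) (y : τ → ℂ) (p : MvPolynomial (σ ⊕ τ) ℂ) :
    aeval x (specRight y p) = aeval (Sum.elim x y) p := by
  have : (aeval x).comp (specRight y) = aeval (R := ℂ) (Sum.elim x y) := by
    ext i
    cases i <;> simp [specRight]
  exact DFunLike.congr_fun this p

theorem mem_vanishingIdeal_prodSet {V : Set (σ → ℂ)} {W : Set (τ → ℂ)}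
    {p : MvPolynomial (σ ⊕ τ) ℂ} :
    p ∈ vanishingIdeal ℂ (prodSet V W) ↔ ∀ x ∈ V, ∀ y ∈ W, aeval (Sum.elim x y) p = 0 := by
  refine ⟨fun h x hx y hy => h _ (sumElim_mem_prodSet hx hy), fun h z hz => ?_⟩
  rw [← Sum.elim_comp_inl_inr z]
  exact h _ hz.1 _ hz.2

/-- If `p(x₁, y₁)` and `q(x₂, y₂)` are nonzero but `pq` vanishes on the product, then for every `y`
one of the slices `p(·, y)`, `q(·, y)` vanishes on `V`. So `p(x₁, ·) q(x₂, ·)` vanishes on `W`, and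
one of its factors does, a contradiction. -/
theorem isPrime_vanishingIdeal_prodSet {V : Set (σ → ℂ)} {W : Set (τ → ℂ)}
    (hV : (vanishingIdeal ℂ V).IsPrime) (hW : (vanishingIdeal ℂ W).IsPrime) :
    (vanishingIdeal ℂ (prodSet V W)).IsPrime := by
  have hne : ∀ {κ : Type _} {U : Set (κ → ℂ)}, (vanishingIdeal ℂ U).IsPrime → U.Nonempty := by
    intro κ U hU
    rw [Set.nonempty_iff_ne_empty]
    rintro rfl
    exact hU.ne_top (vanishingIdeal_empty)
  have hne' : W.Nonempty := by
    rw [Set.nonempty_iff_ne_empty]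
    rintro rfl
    exact hW.ne_top (vanishingIdeal_empty)
  obtain ⟨x₀, hx₀⟩ := hne hV
  obtain ⟨y₀, hy₀⟩ := hne'
  refine ⟨fun h => ?_, fun {p q} hpq => ?_⟩
  · have h1 : (1 : MvPolynomial (σ ⊕ τ) ℂ) ∈ vanishingIdeal ℂ (prodSet V W) := by simp [h]
    have := h1 _ (sumElim_mem_prodSet hx₀ hy₀)
    simp at this
  · simp only [mem_vanishingIdeal_prodSet] at hpq ⊢
    by_contra! hcon
    obtain ⟨⟨x₁, hx₁, y₁, hy₁, h1⟩, ⟨x₂, hx₂, y₂, hy₂, h2⟩⟩ := hcon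
    have key : specLeft x₁ p * specLeft x₂ q ∈ vanishingIdeal ℂ W := by
      intro y hy
      have : specRight y p * specRight y q ∈ vanishingIdeal ℂ V := by
        intro x hx
        rw [map_mul, aeval_specRight, aeval_specRight, ← map_mul]
        exact hpq x hx y hy
      rw [map_mul, aeval_specLeft, aeval_specLeft]
      rcases hV.mem_or_mem this with h | h
      · rw [← aeval_specRight, h _ hx₁, zero_mul]
      · rw [← aeval_specRight x₂, h _ hx₂, mul_zero]
    rcases hW.mem_or_mem key with h | h
    · exact h1 ((aeval_specLeft _ _ _).symm.trans (h _ hy₁))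
    · exact h2 ((aeval_specLeft _ _ _).symm.trans (h _ hy₂))

/-- The inclusion of the polynomials in the first group of variables. -/
noncomputable def inclLeft : MvPolynomial σ ℂ →ₐ[ℂ] MvPolynomial (σ ⊕ τ) ℂ := rename Sum.inl

/-- The inclusion of the polynomials in the second group of variables. -/
noncomputable def inclRight : MvPolynomial τ ℂ →ₐ[ℂ] MvPolynomial (σ ⊕ τ) ℂ := rename Sum.inr

theorem aeval_inclLeft {S : Type*} [CommRing S] [Algebra ℂ S] (x : σ → S) (y : τ → S)
    (p : MvPolynomial σ ℂ) :
    aeval (Sum.elim x y) (inclLeft (τ := τ) p) = aeval x p := by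
  simp [inclLeft, aeval_rename]

theorem aeval_inclRight {S : Type*} [CommRing S] [Algebra ℂ S] (x : σ → S) (y : τ → S)
    (p : MvPolynomial τ ℂ) :
    aeval (Sum.elim x y) (inclRight (σ := σ) p) = aeval y p := by
  simp [inclRight, aeval_rename]

theorem exists_sum_products (p : MvPolynomial (σ ⊕ τ) ℂ) :
    ∃ l : List (MvPolynomial σ ℂ × MvPolynomial τ ℂ),
      p = (l.map fun ab => inclLeft ab.1 * inclRight ab.2).sum := by
  induction p using MvPolynomial.induction_on with
  | C a => exact ⟨[(C a, 1)], by simp [inclLeft, inclRight]⟩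
  | add p q hp hq =>
    obtain ⟨l, rfl⟩ := hp
    obtain ⟨m, rfl⟩ := hq
    exact ⟨l ++ m, by simp⟩
  | mul_X p i hp =>
    obtain ⟨l, rfl⟩ := hp
    cases i with
    | inl i =>
      refine ⟨l.map fun ab => (ab.1 * X i, ab.2), ?_⟩
      rw [← List.sum_map_mul_right, List.map_map]
      congr 2
      funext ab
      simp [inclLeft, inclRight]
      ring
    | inr i =>
      refine ⟨l.map fun ab => (ab.1, ab.2 * X i), ?_⟩
      rw [← List.sum_map_mul_right, List.map_map]
      congr 2
      funext ab
      simp [inclLeft, inclRight]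
      ring

/-- The vanishing ideal of a product is generated by the vanishing ideals of the factors. -/
theorem vanishingIdeal_prodSet_le (V : Set (σ → ℂ)) (W : Set (τ → ℂ)) :
    vanishingIdeal ℂ (prodSet V W) ≤
      (vanishingIdeal ℂ V).map (inclLeft (τ := τ)) ⊔
        (vanishingIdeal ℂ W).map (inclRight (σ := σ)) := by
  set K := (vanishingIdeal ℂ V).map (inclLeft (τ := τ)) ⊔
    (vanishingIdeal ℂ W).map (inclRight (σ := σ)) with hK
  have hKl : ∀ a ∈ vanishingIdeal ℂ V, inclLeft a ∈ K := fun a ha =>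
    Ideal.mem_sup_left (Ideal.mem_map_of_mem _ ha)
  have hKr : ∀ b ∈ vanishingIdeal ℂ W, inclRight b ∈ K := fun b hb =>
    Ideal.mem_sup_right (Ideal.mem_map_of_mem _ hb)
  have hvan : ∀ p ∈ K, ∀ x ∈ V, ∀ y ∈ W, aeval (Sum.elim x y) p = 0 := by
    have : K ≤ vanishingIdeal ℂ (prodSet V W) := by
      refine sup_le (Ideal.map_le_iff_le_comap.2 fun a ha => ?_)
        (Ideal.map_le_iff_le_comap.2 fun b hb => ?_)
      · exact mem_vanishingIdeal_prodSet.2 fun x hx y hy => by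
          rw [aeval_inclLeft]; exact ha x hx
      · exact mem_vanishingIdeal_prodSet.2 fun x hx y hy => by
          rw [aeval_inclRight]; exact hb y hy
    exact fun p hp => mem_vanishingIdeal_prodSet.1 (this hp)
  have main : ∀ (N : ℕ) (l : List (MvPolynomial σ ℂ × MvPolynomial τ ℂ)), l.length = N →
      (∀ x ∈ V, ∀ y ∈ W,
        aeval (Sum.elim x y) (l.map fun ab => inclLeft ab.1 * inclRight ab.2).sum = 0) →
      (l.map fun ab => inclLeft ab.1 * inclRight ab.2).sum ∈ K := by
    intro N
    induction N with
    | zero =>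
      intro l hl _
      rw [List.length_eq_zero_iff.1 hl]
      simp
    | succ N ih =>
      rintro (_ | ⟨⟨a, b⟩, l⟩) hl h
      · simp at hl
      · have hl' : l.length = N := by simpa using hl
        simp only [List.map_cons, List.sum_cons] at h ⊢
        by_cases ha : a ∈ vanishingIdeal ℂ V
        · refine K.add_mem (K.mul_mem_right _ (hKl a ha)) (ih l hl' fun x hx y hy => ?_)
          have := h x hx y hy
          rwa [map_add, map_mul, aeval_inclLeft, ha x hx, zero_mul, zero_add] at this
        · simp only [mem_vanishingIdeal_iff, not_forall] at ha
          obtain ⟨x₀, hx₀, ha₀⟩ := ha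
          -- `b` is a combination of the other factors modulo the ideal of `W`
          set c := (aeval x₀ a)⁻¹ with hc
          let b' : MvPolynomial τ ℂ :=
            b + (l.map fun ab => C (c * aeval x₀ ab.1) * ab.2).sum
          have hb' : b' ∈ vanishingIdeal ℂ W := by
            intro y hy
            have h1 := h x₀ hx₀ y hy
            simp only [map_add, map_mul, aeval_inclLeft, aeval_inclRight, map_list_sum,
              List.map_map, Function.comp_def] at h1
            simp only [b', map_add, map_list_sum, List.map_map, Function.comp_def, map_mul,
              algHom_C, Algebra.algebraMap_self, RingHom.id_apply, mul_assoc,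
              List.sum_map_mul_left]
            have h2 : aeval y b = c * (aeval x₀ a * aeval y b) := by
              rw [hc, inv_mul_cancel_left₀ ha₀]
            rw [h2, ← mul_add, h1, mul_zero]
          -- Replacing `b` by `b'`, which vanishes on `W`, is compensated by changing the left
          -- factors of the remaining terms, so their number does not grow.
          let m : List (MvPolynomial σ ℂ × MvPolynomial τ ℂ) :=
            l.map fun ab => (ab.1 - a * C (c * aeval x₀ ab.1), ab.2)
          have hm : (m.map fun ab => inclLeft ab.1 * inclRight ab.2).sum =
              (l.map fun ab => inclLeft ab.1 * inclRight ab.2).sum -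
                inclLeft a * inclRight (b' - b) := by
            simp only [m, b', add_sub_cancel_left, List.map_map, Function.comp_def]
            clear hl' h hb' b' m hl
            induction l with
            | nil => simp
            | cons d l ihl =>
              simp only [List.map_cons, List.sum_cons]
              rw [ihl]
              simp only [map_add, map_sub, map_mul]
              simp only [inclLeft, inclRight, algHom_C, algebraMap_eq]
              ring
          have hsum : inclLeft a * inclRight b +
              (l.map fun ab => inclLeft ab.1 * inclRight ab.2).sum =
              inclLeft a * inclRight b' + (m.map fun ab => inclLeft ab.1 * inclRight ab.2).sum := by
            rw [hm, map_sub]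
            ring
          have hmem : inclLeft a * inclRight b' ∈ K := K.mul_mem_left _ (hKr _ hb')
          rw [hsum] at h ⊢
          refine K.add_mem hmem (ih m (by simp [m, hl']) fun x hx y hy => ?_)
          have := h x hx y hy
          rwa [map_add, hvan _ hmem x hx y hy, zero_add] at this
  intro p hp
  obtain ⟨l, rfl⟩ := exists_sum_products p
  exact main _ l rfl (mem_vanishingIdeal_prodSet.1 hp)

end Product

end HermitianDistance

namespace HermitianDistance

open MvPolynomial

/-! ### Derivations of function fields and tangent vectors. -/

section Derivations

/-- A derivation with values in a finitely generated field extension extends to that field. -/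
theorem exists_derivation_extension {k A L : Type*} [Field k] [CharZero k] [CommRing A] [IsDomain A]
    [Field L] [Algebra k A] [Algebra k L] [Algebra A L] [IsScalarTower k A L]
    (hinj : Function.Injective (algebraMap A L)) [Algebra.EssFiniteType k L]
    (D : Derivation k A L) :
    ∃ D' : Derivation k L L, ∀ a, D' (algebraMap A L a) = D a := by
  have : FaithfulSMul A L := (faithfulSMul_iff_algebraMap_injective A L).mpr hinj
  let F := FractionRing A
  let _ : Algebra F L := FractionRing.liftAlgebra A L
  have : IsScalarTower A F L := FractionRing.isScalarTower_liftAlgebra A L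
  have : IsScalarTower k F L := IsScalarTower.to₁₃₄ k A F L
  have : Algebra.EssFiniteType F L := Algebra.EssFiniteType.of_comp k F L
  have : CharZero F := charZero_of_injective_algebraMap (algebraMap k F).injective
  have : Algebra.FormallyEtale A F := Algebra.FormallyEtale.of_isLocalization (nonZeroDivisors A)
  have : Algebra.FormallySmooth F L := Algebra.FormallySmooth.of_perfectField
  have : Algebra.FormallySmooth A L := Algebra.FormallySmooth.comp A F L
  -- In characteristic zero `L` is formally smooth over `A`, so the first cotangent homology
  -- vanishes and `L ⊗ Ω_A → Ω_L` is injective. A linear left inverse then extends the derivation.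
  have hker : LinearMap.ker (KaehlerDifferential.mapBaseChange k A L) = ⊥ := by
    rw [LinearMap.ker_eq_bot']
    intro x hx
    obtain ⟨x, rfl⟩ := (Algebra.H1Cotangent.exact_δ_mapBaseChange k A L x).mp hx
    rw [Subsingleton.elim x 0, map_zero]
  obtain ⟨g, hg⟩ := LinearMap.exists_leftInverse_of_injective _ hker
  let φ : TensorProduct A L (KaehlerDifferential k A) →ₗ[L] L :=
    D.liftKaehlerDifferential.liftBaseChange L
  refine ⟨(φ.comp g).compDer (KaehlerDifferential.D k L), fun a => ?_⟩
  have h1 : KaehlerDifferential.D k L (algebraMap A L a) =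
      KaehlerDifferential.mapBaseChange k A L (1 ⊗ₜ KaehlerDifferential.D k A a) := by
    simp
  have h2 := LinearMap.congr_fun hg (1 ⊗ₜ KaehlerDifferential.D k A a)
  simp only [LinearMap.comp_apply, LinearMap.id_apply] at h2
  change φ (g (KaehlerDifferential.D k L (algebraMap A L a))) = D a
  rw [h1, h2]
  simp [φ]

/-- Evaluation on a separating transcendence basis is an isomorphism: a derivation killing the basis
is zero by separability, and arbitrary values extend from the polynomial ring by
`exists_derivation_extension`. -/
theorem finrank_derivation {k L : Type*} [Field k] [CharZero k] [Field L] [Algebra k L]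
    [Algebra.EssFiniteType k L] :
    Module.finrank L (Derivation k L L) = (Algebra.trdeg k L).toNat ∧
      Module.Finite L (Derivation k L L) := by
  obtain ⟨s, hs, hsep⟩ := exists_isTranscendenceBasis_and_isSeparable_of_perfectField k L
  let ev : Derivation k L L →ₗ[L] (s → L) :=
    { toFun := fun D i => D i
      map_add' := fun _ _ => rfl
      map_smul' := fun _ _ => rfl }
  have hinj : Function.Injective ev := by
    rw [← LinearMap.ker_eq_bot, LinearMap.ker_eq_bot']
    intro D hD
    have h0 : ∀ x ∈ IntermediateField.adjoin k (s : Set L), D x = 0 := by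
      intro x hx
      induction hx using IntermediateField.adjoin_induction with
      | mem x hx => exact congrFun hD ⟨x, hx⟩
      | algebraMap x => simp
      | add x y _ _ hx hy => simp [hx, hy]
      | inv x _ hx => simp [Derivation.leibniz_inv, hx]
      | mul x y _ _ hx hy => simp [hx, hy]
    let D' : Derivation (IntermediateField.adjoin k (s : Set L)) L L :=
      Derivation.mk'
        { toFun := D
          map_add' := fun x y => D.map_add x y
          map_smul' := fun c x => by
            simp [Algebra.smul_def, h0 c.1 c.2] }
        (fun a b => by simp)
    have := Algebra.FormallyEtale.of_isSeparable (IntermediateField.adjoin k (s : Set L)) L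
    have h1 : D' = 0 := by
      have := (KaehlerDifferential.linearMapEquivDerivation
        (IntermediateField.adjoin k (s : Set L)) L (M := L)).symm.injective
      apply this
      exact LinearMap.ext fun x => by rw [Subsingleton.elim x 0, map_zero, map_zero]
    ext x
    exact congrArg (fun E => E x) h1
  have hsurj : Function.Surjective ev := by
    intro v
    let _ : Algebra (MvPolynomial s k) L := (aeval (fun i : s => (i : L))).toAlgebra
    have : IsScalarTower k (MvPolynomial s k) L := IsScalarTower.of_algebraMap_eq' (by
      ext x
      simp [RingHom.algebraMap_toAlgebra])
    have h : Function.Injective (algebraMap (MvPolynomial s k) L) := hs.1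
    obtain ⟨D', hD'⟩ := exists_derivation_extension h (mkDerivation k v)
    refine ⟨D', funext fun i => ?_⟩
    have := hD' (X i)
    simp only [RingHom.algebraMap_toAlgebra, mkDerivation_X] at this
    change D' i = v i
    simpa using this
  let e := LinearEquiv.ofBijective ev ⟨hinj, hsurj⟩
  refine ⟨?_, Module.Finite.equiv e.symm⟩
  rw [e.finrank_eq, ← hs.cardinalMk_eq_trdeg]
  simp

theorem derivation_aeval {k σ L : Type*} [Fintype σ] [CommRing k] [CommRing L] [Algebra k L]
    (D : Derivation k L L) (z : σ → L) (p : MvPolynomial σ k) :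
    D (aeval z p) = ∑ j, aeval z (pderiv j p) * D (z j) := by
  classical
  induction p using MvPolynomial.induction_on with
  | C a => simp
  | add p q hp hq => simp [hp, hq, add_mul, Finset.sum_add_distrib]
  | mul_X p i hp =>
    simp only [map_mul, aeval_X, Derivation.leibniz, smul_eq_mul, hp, map_add, pderiv_X, add_mul,
      Finset.sum_add_distrib, Finset.mul_sum, Pi.single_apply]
    congr 1
    · rw [Finset.sum_eq_single i]
      · simp
      · intro b _ hb
        simp [Ne.symm hb]
      · simp
    · exact Finset.sum_congr rfl fun j _ => by ring

/-- Tangent vectors at a generic point come from derivations of the field. -/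
theorem exists_derivation_of_tangent {k σ L : Type*} [Fintype σ] [Field k] [CharZero k] [Field L]
    [Algebra k L] [Algebra.EssFiniteType k L] {I : Ideal (MvPolynomial σ k)} {z : σ → L}
    (hI : ∀ p, aeval z p = 0 ↔ p ∈ I) {a : σ → L}
    (ha : ∀ p ∈ I, ∑ j, aeval z (pderiv j p) * a j = 0) :
    ∃ D : Derivation k L L, ∀ j, D (z j) = a j := by
  classical
  let A := (aeval (R := k) z).range
  let π : MvPolynomial σ k →ₐ[k] A := (aeval z).rangeRestrict
  have hπ : Function.Surjective π := (aeval z).rangeRestrict_surjective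
  let D₀ : MvPolynomial σ k →ₗ[k] L :=
    ∑ j, (LinearMap.mulRight k (a j)).comp
      ((aeval (R := k) z).toLinearMap.comp (pderiv j).toLinearMap)
  have hD₀ : ∀ p, D₀ p = ∑ j, aeval z (pderiv j p) * a j := fun p => by
    simp [D₀, LinearMap.sum_apply]
  -- Tangency of `a` is what makes the derivation in direction `a` descend to the coordinate ring of
  -- the generic point.
  have key : ∀ p q, π p = π q → D₀ p = D₀ q := by
    intro p q h
    have h1 : p - q ∈ I := by
      rw [← hI, map_sub, sub_eq_zero]
      exact congrArg Subtype.val h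
    rw [← sub_eq_zero, ← map_sub, hD₀]
    exact ha _ h1
  let r := Function.surjInv hπ
  have hr : ∀ x, π (r x) = x := Function.surjInv_eq hπ
  let D₁ : Derivation k A L := Derivation.mk'
    { toFun := fun x => D₀ (r x)
      map_add' := fun x y => by
        rw [← map_add]
        exact key _ _ (by simp only [map_add, hr])
      map_smul' := fun c x => by
        rw [RingHom.id_apply, ← map_smul]
        exact key _ _ (by simp only [map_smul, hr]) }
    (fun x y => by
      have h1 : D₀ (r (x * y)) = D₀ (r x * r y) := key _ _ (by simp only [map_mul, hr])
      change D₀ (r (x * y)) = x • D₀ (r y) + y • D₀ (r x)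
      have hx : ∀ x, aeval z (r x) = (x : L) := fun x => congrArg Subtype.val (hr x)
      rw [h1, hD₀, hD₀, hD₀]
      change _ = (x : L) * _ + (y : L) * _
      simp only [Derivation.leibniz, map_add, smul_eq_mul, map_mul, Finset.mul_sum,
        hx, add_mul, Finset.sum_add_distrib, mul_assoc])
  obtain ⟨D, hD⟩ := exists_derivation_extension (k := k) (A := A) (L := L)
    Subtype.val_injective D₁
  refine ⟨D, fun j => ?_⟩
  have h1 := hD (π (X j))
  have h2 : algebraMap A L (π (X j)) = z j := by
    change aeval z (X j) = z j
    simp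
  have h3 : D₁ (π (X j)) = D₀ (X j) := key _ _ (hr _)
  rw [h2, h3, hD₀] at h1
  rw [h1, Finset.sum_eq_single j]
  · simp
  · intro b _ hb
    simp [pderiv_X_of_ne (Ne.symm hb)]
  · simp

end Derivations

end HermitianDistance

namespace HermitianDistance

open MvPolynomial

/-! ### The generic rank of the Jacobian. -/

section GenericRank

variable {n s : ℕ} (f : Fin s → MvPolynomial (Fin n) ℂ)

theorem tangent_of_generators {L : Type*} [Field L] [Algebra ℂ L] {z a : Fin n → L}
    (hz : ∀ p ∈ ideal f, aeval z p = 0)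
    (ha : ∀ i, ∑ j, aeval z (pderiv j (f i)) * a j = 0) :
    ∀ p ∈ ideal f, ∑ j, aeval z (pderiv j p) * a j = 0 := by
  intro p hp
  induction hp using Submodule.span_induction with
  | mem x hx => obtain ⟨i, rfl⟩ := hx; exact ha i
  | zero => simp
  | add x y _ _ hx hy => simp [add_mul, Finset.sum_add_distrib, hx, hy]
  | smul q x hx h =>
    have h1 : aeval z x = 0 := hz x hx
    simp only [smul_eq_mul, Derivation.leibniz, map_add, map_mul, h1, zero_mul, add_zero,
      mul_assoc]
    rw [← Finset.mul_sum, h, mul_zero]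

theorem trdeg_coordinateRing_le (I : Ideal (MvPolynomial (Fin n) ℂ)) :
    Algebra.trdeg ℂ (MvPolynomial (Fin n) ℂ ⧸ I) ≤ n := by
  have := trdeg_le_of_surjective (Ideal.Quotient.mkₐ ℂ I) (Ideal.Quotient.mkₐ_surjective ℂ I)
  simpa using this

/-- The kernel of the Jacobian at the generic point is the space of derivations of the function
field, whose dimension is the transcendence degree. Rank-nullity gives the codimension. -/
theorem rank_jacobian_generic (hprime : (ideal f).IsPrime) (L : Type) [Field L]
    [Algebra (MvPolynomial (Fin n) ℂ ⧸ ideal f) L]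
    [IsFractionRing (MvPolynomial (Fin n) ℂ ⧸ ideal f) L] [Algebra ℂ L]
    [IsScalarTower ℂ (MvPolynomial (Fin n) ℂ ⧸ ideal f) L] :
    ((jacobian f).map fun p => algebraMap (MvPolynomial (Fin n) ℂ ⧸ ideal f) L
      (Ideal.Quotient.mk _ p)).rank = codim f := by
  let A := MvPolynomial (Fin n) ℂ ⧸ ideal f
  let z : Fin n → L := fun j => algebraMap A L (Ideal.Quotient.mk _ (X j))
  have hza : ∀ p, aeval z p = algebraMap A L (Ideal.Quotient.mk _ p) := by
    intro p
    have : aeval z = (IsScalarTower.toAlgHom ℂ A L).comp (Ideal.Quotient.mkₐ ℂ (ideal f)) := by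
      ext j
      simp [z, A]
    rw [this]
    rfl
  have hI : ∀ p, aeval z p = 0 ↔ p ∈ ideal f := by
    intro p
    rw [hza]
    rw [map_eq_zero_iff _ (IsFractionRing.injective A L), Ideal.Quotient.eq_zero_iff_mem]
  have : Algebra.EssFiniteType A L := Algebra.EssFiniteType.of_isLocalization _ (nonZeroDivisors A)
  have : Algebra.EssFiniteType ℂ L := Algebra.EssFiniteType.comp ℂ A L
  let M : Matrix (Fin s) (Fin n) L := (jacobian f).map fun p => algebraMap A L (Ideal.Quotient.mk _ p)
  let ev : Derivation ℂ L L →ₗ[L] LinearMap.ker M.mulVecLin :=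
    { toFun := fun D => ⟨fun j => D (z j), by
        rw [LinearMap.mem_ker, Matrix.mulVecLin_apply]
        ext i
        have h := derivation_aeval D z (f i)
        rw [(hI _).2 (Ideal.subset_span ⟨i, rfl⟩), map_zero] at h
        simp only [M, Matrix.mulVec, dotProduct, jacobian, Matrix.map_apply, Matrix.of_apply,
          ← hza]
        exact h.symm⟩
      map_add' := fun _ _ => rfl
      map_smul' := fun _ _ => rfl }
  have hinj : Function.Injective ev := by
    rw [← LinearMap.ker_eq_bot, LinearMap.ker_eq_bot']
    intro D hD
    have h0 : ∀ j, D (z j) = 0 := fun j => congrFun (congrArg Subtype.val hD) j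
    have h1 : ∀ a : A, D (algebraMap A L a) = 0 := by
      intro a
      obtain ⟨p, rfl⟩ := Ideal.Quotient.mk_surjective a
      have := derivation_aeval D z p
      rw [hza] at this
      simp only [h0, mul_zero, Finset.sum_const_zero] at this
      exact this
    ext x
    obtain ⟨a, b, -, rfl⟩ := IsFractionRing.div_surjective (A := A) x
    rw [Derivation.leibniz_div, h1, h1]
    simp
  have hsurj : Function.Surjective ev := by
    rintro ⟨a, ha⟩
    have ha' : ∀ i, ∑ j, aeval z (pderiv j (f i)) * a j = 0 := by
      intro i
      have := congrFun (LinearMap.mem_ker.1 ha) i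
      simp only [hza]
      exact this
    obtain ⟨D, hD⟩ := exists_derivation_of_tangent hI
      (tangent_of_generators f (fun p hp => (hI p).2 hp) ha')
    exact ⟨D, Subtype.ext (funext hD)⟩
  have hd := (LinearEquiv.ofBijective ev ⟨hinj, hsurj⟩).finrank_eq
  rw [finrank_derivation.1] at hd
  have htr : Algebra.trdeg ℂ L = Algebra.trdeg ℂ A := by
    have : Algebra.IsAlgebraic A L := 
      IsFractionRing.comap_isAlgebraic_iff (K := L).mpr inferInstance
    have hf : FaithfulSMul A L :=
      (faithfulSMul_iff_algebraMap_injective A L).mpr (IsFractionRing.injective A L)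
    rw [← trdeg_add_eq ℂ A (A := L), trdeg_eq_zero_iff.2 this, add_zero]
  rw [htr] at hd
  have hr := LinearMap.finrank_range_add_finrank_ker M.mulVecLin
  rw [← hd, Module.finrank_fin_fun] at hr
  change M.rank = n - _
  rw [Matrix.rank]
  dsimp only [A] at hr
  omega

end GenericRank

end HermitianDistance

namespace HermitianDistance

open MvPolynomial

/-! ### Generic points, and row spaces over a field. -/

section GenericPoint

/-- A prime ideal has a generic point in a finitely generated field. -/
theorem exists_generic_point {σ : Type} [Finite σ] (P : Ideal (MvPolynomial σ ℂ))
    (hP : P.IsPrime) :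
    ∃ (L : Type) (_ : Field L) (_ : Algebra ℂ L) (_ : Algebra.EssFiniteType ℂ L) (η : σ → L),
      ∀ p, aeval η p = 0 ↔ p ∈ P := by
  let A := MvPolynomial σ ℂ ⧸ P
  let L := FractionRing A
  have : Algebra.EssFiniteType A L := Algebra.EssFiniteType.of_isLocalization _ (nonZeroDivisors A)
  refine ⟨L, inferInstance, inferInstance, Algebra.EssFiniteType.comp ℂ A L,
    fun j => algebraMap A L (Ideal.Quotient.mk _ (X j)), fun p => ?_⟩
  have : aeval (fun j => algebraMap A L (Ideal.Quotient.mk _ (X j))) =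
      (IsScalarTower.toAlgHom ℂ A L).comp (Ideal.Quotient.mkₐ ℂ P) := by
    ext j
    simp [A]
  rw [this]
  change algebraMap A L (Ideal.Quotient.mk _ p) = 0 ↔ _
  rw [map_eq_zero_iff _ (IsFractionRing.injective A L), Ideal.Quotient.eq_zero_iff_mem]

end GenericPoint

section LinearAlgebra

/-- The range of the dual map is the annihilator of the kernel. This identifies normal vectors with
the row space of the Jacobian. -/
theorem exists_vecMul_of_orthogonal_ker {K ρ κ : Type*} [Field K] [Fintype ρ] [Fintype κ]
    (M : Matrix ρ κ K) {y : κ → K} (h : ∀ x, M.mulVec x = 0 → y ⬝ᵥ x = 0) :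
    ∃ ℓ : ρ → K, y = Matrix.vecMul ℓ M := by
  classical
  let φ : Module.Dual K (κ → K) := ∑ j, y j • LinearMap.proj j
  have hφ : ∀ x, φ x = y ⬝ᵥ x := fun x => by simp [φ, dotProduct]
  have h1 : φ ∈ M.mulVecLin.ker.dualAnnihilator := by
    rw [Submodule.mem_dualAnnihilator]
    exact fun x hx => (hφ x).trans (h x hx)
  rw [← LinearMap.range_dualMap_eq_dualAnnihilator_ker] at h1
  obtain ⟨ψ, hψ⟩ := h1
  refine ⟨fun i => ψ (Pi.single i 1), funext fun j => ?_⟩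
  have h2 := LinearMap.congr_fun hψ (Pi.single j 1)
  rw [hφ, dotProduct_single_one] at h2
  rw [← h2, LinearMap.dualMap_apply, Matrix.mulVecLin_apply, Matrix.mulVec_single_one]
  have h3 : M.col j = ∑ i, M i j • (Pi.single i 1 : ρ → K) := by
    ext i
    simp [Finset.sum_apply, Pi.single_apply]
  rw [h3, map_sum]
  simp [Matrix.vecMul, dotProduct, mul_comm]

theorem rank_le_of_minors {K ρ κ : Type*} [Field K] [Fintype ρ] [Fintype κ]
    {M : Matrix ρ κ K} {c : ℕ} {a : Fin c → ρ} {b : Fin c → κ} (h : (M.submatrix a b).det ≠ 0)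
    (hM : ∀ (a : Fin (c + 1) → ρ) (b : Fin (c + 1) → κ), (M.submatrix a b).det = 0) :
    M.rank ≤ c := by
  have h1 : ∀ i, M i = Matrix.vecMul (Matrix.vecMul (M i ∘ b) (M.submatrix a b)⁻¹)
      (M.submatrix a id) := fun i => by
    refine eq_vecMul_of_minors_eq_zero (isUnit_iff_ne_zero.2 h) fun j => ?_
    rw [← hM (Fin.cons i a) (Fin.cons j b)]
    congr 1
    ext x y
    refine Fin.cases ?_ (fun x => ?_) x <;> simp
  have h2 : M = (Matrix.of fun i => Matrix.vecMul (M i ∘ b) (M.submatrix a b)⁻¹) *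
      M.submatrix a id := by
    ext i j
    exact congrFun (h1 i) j
  rw [h2]
  exact (Matrix.rank_mul_le_right _ _).trans (Matrix.rank_le_card_height _) |>.trans (by simp)

theorem minor_cons_vecMul_eq_zero {K : Type*} [Field K] {n s c : ℕ}
    {M : Matrix (Fin s) (Fin n) K} (hM : M.rank ≤ c) (ℓ : Fin s → K)
    (a : Fin (c + 1) → Fin (s + 1)) (b : Fin (c + 1) → Fin n) :
    ((Matrix.of (Fin.cons (Matrix.vecMul ℓ M) M) : Matrix (Fin (s + 1)) (Fin n) K).submatrix
      a b).det = 0 := by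
  refine minor_eq_zero_of_rank_lt (Nat.lt_succ_of_le (le_trans ?_ hM)) a b
  have : (Matrix.of (Fin.cons (Matrix.vecMul ℓ M) M) : Matrix (Fin (s + 1)) (Fin n) K) =
      (Matrix.of (Fin.cons ℓ (1 : Matrix (Fin s) (Fin s) K)) : Matrix (Fin (s + 1)) (Fin s) K) *
        M := by
    ext i j
    refine Fin.cases ?_ (fun i => ?_) i
    · rfl
    · rw [Matrix.mul_apply]
      change M i j = ∑ k, (1 : Matrix (Fin s) (Fin s) K) i k * M k j
      simp [Matrix.one_apply]
  rw [this]
  exact Matrix.rank_mul_le_right _ _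

end LinearAlgebra

/-! ### The conormal variety. -/

section Conormal

variable {n s : ℕ} (f : Fin s → MvPolynomial (Fin n) ℂ)

/-- The Jacobian matrix evaluated at a point with coordinates in a `ℂ`-algebra. -/
noncomputable def jacobianAt {S : Type*} [CommRing S] [Algebra ℂ S] (z : Fin n → S) :
    Matrix (Fin s) (Fin n) S :=
  (jacobian f).map (aeval z)

/-- The pairs `(z, y)` with `z` in the variety and `y` in the row space of the Jacobian at `z`. -/
def conormalSet : Set (Fin n ⊕ Fin n → ℂ) :=
  {x | ∃ z ∈ variety f, ∃ ℓ : Fin s → ℂ, x = Sum.elim z (Matrix.vecMul ℓ (jacobianAt f z))}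

/-- The ideal of the conormal variety. -/
noncomputable def conormalVanishing : Ideal (MvPolynomial (Fin n ⊕ Fin n) ℂ) :=
  vanishingIdeal ℂ (conormalSet f)

/-- The comorphism of the parametrisation `(z, ℓ) ↦ (z, ℓ J(z))`. -/
noncomputable def conormalParam :
    MvPolynomial (Fin n ⊕ Fin n) ℂ →ₐ[ℂ] MvPolynomial (Fin n ⊕ Fin s) ℂ :=
  aeval (Sum.elim (fun j => X (Sum.inl j))
    (fun j => ∑ i, X (Sum.inr i) * inclLeft (jacobian f i j)))

theorem aeval_conormalParam {S : Type*} [CommRing S] [Algebra ℂ S] (z : Fin n → S) (ℓ : Fin s → S)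
    (h : MvPolynomial (Fin n ⊕ Fin n) ℂ) :
    aeval (Sum.elim z ℓ) (conormalParam f h) =
      aeval (Sum.elim z (Matrix.vecMul ℓ (jacobianAt f z))) h := by
  have : (aeval (Sum.elim z ℓ)).comp (conormalParam f) =
      aeval (R := ℂ) (Sum.elim z (Matrix.vecMul ℓ (jacobianAt f z))) := by
    ext j
    cases j with
    | inl j => simp [conormalParam]
    | inr j => simp [conormalParam, aeval_inclLeft, Matrix.vecMul, dotProduct, jacobianAt]
  exact DFunLike.congr_fun this h

theorem mem_conormalVanishing {h : MvPolynomial (Fin n ⊕ Fin n) ℂ} :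
    h ∈ conormalVanishing f ↔ ∀ z ∈ variety f, ∀ ℓ : Fin s → ℂ,
      aeval (Sum.elim z (Matrix.vecMul ℓ (jacobianAt f z))) h = 0 := by
  refine ⟨fun hh z hz ℓ => hh _ ⟨z, hz, ℓ, rfl⟩, ?_⟩
  rintro hh _ ⟨z, hz, ℓ, rfl⟩
  exact hh z hz ℓ

theorem mem_conormalVanishing_iff_param {h : MvPolynomial (Fin n ⊕ Fin n) ℂ} :
    h ∈ conormalVanishing f ↔
      conormalParam f h ∈ vanishingIdeal ℂ (prodSet (variety f) (Set.univ : Set (Fin s → ℂ))) := by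
  rw [mem_conormalVanishing, mem_vanishingIdeal_prodSet]
  simp [aeval_conormalParam]

theorem vanishingIdeal_univ {σ : Type*} : vanishingIdeal ℂ (Set.univ : Set (σ → ℂ)) = ⊥ := by
  rw [eq_bot_iff]
  intro p hp
  exact MvPolynomial.funext fun x => by simpa using hp x (Set.mem_univ x)

variable {f}

theorem vanishingIdeal_variety (hprime : (ideal f).IsPrime) :
    vanishingIdeal ℂ (variety f) = ideal f :=
  IsPrime.vanishingIdeal_zeroLocus (ideal f)

theorem mem_ideal_iff (hprime : (ideal f).IsPrime) {p : MvPolynomial (Fin n) ℂ} :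
    p ∈ ideal f ↔ ∀ z ∈ variety f, aeval z p = 0 := by
  rw [← vanishingIdeal_variety hprime, mem_vanishingIdeal_iff]

theorem aeval_eq_zero_of_mem_ideal {S : Type*} [CommRing S] [Algebra ℂ S] {z : Fin n → S}
    (hz : ∀ i, aeval z (f i) = 0) {p : MvPolynomial (Fin n) ℂ} (hp : p ∈ ideal f) :
    aeval z p = 0 := by
  have : ideal f ≤ RingHom.ker (aeval z : MvPolynomial (Fin n) ℂ →ₐ[ℂ] S) := by
    refine Ideal.span_le.2 ?_
    rintro _ ⟨i, rfl⟩
    exact hz i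
  exact this hp

theorem mem_variety_iff {z : Fin n → ℂ} : z ∈ variety f ↔ ∀ i, aeval z (f i) = 0 :=
  ⟨fun h i => h _ (Ideal.subset_span ⟨i, rfl⟩), fun h _ hp => aeval_eq_zero_of_mem_ideal h hp⟩

theorem isPrime_vanishingIdeal_param (hprime : (ideal f).IsPrime) (τ : Type*) :
    (vanishingIdeal ℂ (prodSet (variety f) (Set.univ : Set (τ → ℂ)))).IsPrime := by
  refine isPrime_vanishingIdeal_prodSet ?_ ?_
  · rwa [vanishingIdeal_variety hprime]
  · rw [vanishingIdeal_univ]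
    exact Ideal.isPrime_bot

/-- The ideal is the contraction of the prime ideal of `X × ℂ^s` along `conormalParam`. -/
theorem isPrime_conormalVanishing (hprime : (ideal f).IsPrime) :
    (conormalVanishing f).IsPrime := by
  have := isPrime_vanishingIdeal_param hprime (Fin s)
  have h : conormalVanishing f = Ideal.comap (conormalParam f)
      (vanishingIdeal ℂ (prodSet (variety f) (Set.univ : Set (Fin s → ℂ)))) := by
    ext h
    exact mem_conormalVanishing_iff_param f
  rw [h]
  exact Ideal.comap_isPrime _ _

/-- The equations of the conormal variety hold at every point of the parametrisation, with
coordinates in any `ℂ`-algebra. -/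
theorem aeval_eq_zero_of_mem_conormalVanishing (hprime : (ideal f).IsPrime) {S : Type*}
    [CommRing S] [Algebra ℂ S] {z : Fin n → S} (hz : ∀ i, aeval z (f i) = 0) (ℓ : Fin s → S)
    {h : MvPolynomial (Fin n ⊕ Fin n) ℂ} (hh : h ∈ conormalVanishing f) :
    aeval (Sum.elim z (Matrix.vecMul ℓ (jacobianAt f z))) h = 0 := by
  rw [← aeval_conormalParam]
  -- The ideal of `X × ℂ^s` is generated by the `f i` themselves, without passing to a radical. This
  -- is why `S` may have nilpotents.
  have h1 := vanishingIdeal_prodSet_le _ _ ((mem_conormalVanishing_iff_param f).1 hh)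
  rw [vanishingIdeal_univ, Ideal.map_bot, sup_bot_eq, vanishingIdeal_variety hprime] at h1
  have h2 : (ideal f).map (inclLeft (τ := Fin s)) ≤
      RingHom.ker (aeval (Sum.elim z ℓ) : MvPolynomial (Fin n ⊕ Fin s) ℂ →ₐ[ℂ] S) := by
    refine Ideal.map_le_iff_le_comap.2 fun p hp => ?_
    change aeval (Sum.elim z ℓ) (inclLeft p) = 0
    rw [aeval_inclLeft]
    exact aeval_eq_zero_of_mem_ideal hz hp
  exact h2 h1

/-- The image of a generic point of `X × ℂ^s`. It is generic on the conormal variety and keeps an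
explicit multiplier `ℓ`, while its first component is generic on `X`. -/
theorem exists_generic_conormal (hprime : (ideal f).IsPrime) :
    ∃ (L : Type) (_ : Field L) (_ : Algebra ℂ L) (_ : Algebra.EssFiniteType ℂ L)
      (z : Fin n → L) (ℓ : Fin s → L), (∀ p, aeval z p = 0 ↔ p ∈ ideal f) ∧
      ∀ h, aeval (Sum.elim z (Matrix.vecMul ℓ (jacobianAt f z))) h = 0 ↔
        h ∈ conormalVanishing f := by
  obtain ⟨L, i1, i2, i3, η, hη⟩ := exists_generic_point _
    (isPrime_vanishingIdeal_param hprime (Fin s))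
  refine ⟨L, i1, i2, i3, η ∘ Sum.inl, η ∘ Sum.inr, fun p => ?_, fun h => ?_⟩
  · rw [← aeval_inclLeft (η ∘ Sum.inl) (η ∘ Sum.inr), Sum.elim_comp_inl_inr, hη,
      mem_vanishingIdeal_prodSet, mem_ideal_iff hprime]
    simp [aeval_inclLeft]
  · rw [← aeval_conormalParam, Sum.elim_comp_inl_inr, hη, mem_conormalVanishing_iff_param]

theorem inclLeft_mem_conormalVanishing (hprime : (ideal f).IsPrime)
    {p : MvPolynomial (Fin n) ℂ} : inclLeft p ∈ conormalVanishing f ↔ p ∈ ideal f := by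
  rw [mem_conormalVanishing, mem_ideal_iff hprime]
  simp [aeval_inclLeft]

variable (f) in
/-- Some `c`-minor of the Jacobian does not vanish on the variety, while all `(c+1)`-minors do. -/
def HasGenericRank (c : ℕ) : Prop :=
  (∃ (a : Fin c → Fin s) (b : Fin c → Fin n), ((jacobian f).submatrix a b).det ∉ ideal f) ∧
    ∀ (a : Fin (c + 1) → Fin s) (b : Fin (c + 1) → Fin n),
      ((jacobian f).submatrix a b).det ∈ ideal f

/-- This links the codimension, defined by transcendence degree, with the size of the minors in the
critical equations. -/
theorem hasGenericRank_codim (hprime : (ideal f).IsPrime) : HasGenericRank f (codim f) := by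
  let A := MvPolynomial (Fin n) ℂ ⧸ ideal f
  let L := FractionRing A
  let φ : MvPolynomial (Fin n) ℂ →+* L := (algebraMap A L).comp (Ideal.Quotient.mk (ideal f))
  have hφ : ∀ p, φ p = 0 ↔ p ∈ ideal f := fun p => by
    change algebraMap A L (Ideal.Quotient.mk _ p) = 0 ↔ _
    rw [map_eq_zero_iff _ (IsFractionRing.injective A L), Ideal.Quotient.eq_zero_iff_mem]
  have hr : ((jacobian f).map φ).rank = codim f := rank_jacobian_generic f hprime L
  have hdet : ∀ {k : ℕ} (a : Fin k → Fin s) (b : Fin k → Fin n),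
      (((jacobian f).map φ).submatrix a b).det = φ ((jacobian f).submatrix a b).det :=
    fun a b => (RingHom.map_det φ _).symm
  refine ⟨?_, fun a b => ?_⟩
  · obtain ⟨a, b, h⟩ := exists_minor_ne_zero hr
    exact ⟨a, b, fun h' => h (by rw [hdet, hφ]; exact h')⟩
  · rw [← hφ, ← hdet]
    exact minor_eq_zero_of_rank_lt (by omega) a b

theorem HasGenericRank.rank_le {c : ℕ} (hc : HasGenericRank f c) {L : Type*} [Field L]
    [Algebra ℂ L] {z : Fin n → L} (hz : ∀ p, aeval z p = 0 ↔ p ∈ ideal f) :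
    (jacobianAt f z).rank ≤ c := by
  have hdet : ∀ {k : ℕ} (a : Fin k → Fin s) (b : Fin k → Fin n),
      ((jacobianAt f z).submatrix a b).det = aeval z ((jacobian f).submatrix a b).det :=
    fun a b => (AlgHom.map_det (aeval z) _).symm
  obtain ⟨⟨a, b, h⟩, h'⟩ := hc
  refine rank_le_of_minors (a := a) (b := b) ?_ fun a b => ?_
  · rw [hdet, Ne, hz]
    exact h
  · rw [hdet, hz]
    exact h' a b

/-- The minors of the Jacobian augmented by a conormal vector vanish on the conormal variety. -/
theorem HasGenericRank.minor_mem {c : ℕ} (hc : HasGenericRank f c) (hprime : (ideal f).IsPrime)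
    (a : Fin (c + 1) → Fin (s + 1)) (b : Fin (c + 1) → Fin n) :
    ((Matrix.of (Fin.cons (fun j => X (Sum.inr j)) fun i j => inclLeft (jacobian f i j)) :
      Matrix (Fin (s + 1)) (Fin n) (MvPolynomial (Fin n ⊕ Fin n) ℂ)).submatrix a b).det ∈
      conormalVanishing f := by
  obtain ⟨L, _, _, _, z, ℓ, hz, hgen⟩ := exists_generic_conormal hprime
  -- Membership is tested at the generic point, where the added row is a combination of rows of a
  -- matrix of rank at most `c`.
  rw [← hgen, ← minor_cons_vecMul_eq_zero (hc.rank_le hz) ℓ a b, AlgHom.map_det]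
  congr 1
  ext x y
  simp only [AlgHom.mapMatrix_apply, Matrix.map_apply, Matrix.submatrix_apply, Matrix.of_apply]
  refine Fin.cases ?_ (fun x => ?_) (a x)
  · simp only [Fin.cons_zero, aeval_X, Sum.elim_inr]
    rfl
  · simp only [Fin.cons_succ, aeval_inclLeft]
    rfl

end Conormal

end HermitianDistance

namespace HermitianDistance

open MvPolynomial

/-! ### Cones and the first half of biduality. -/

section Duality

variable {n s r : ℕ} {f : Fin s → MvPolynomial (Fin n) ℂ} {g : Fin r → MvPolynomial (Fin n) ℂ}

/-- Euler's relation for the equations of a cone. -/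
theorem euler_mem_ideal (hprime : (ideal f).IsPrime)
    (hcone : ∀ (a : ℂ), ∀ z ∈ variety f, a • z ∈ variety f) (i : Fin s) :
    ∑ j, X j * jacobian f i j ∈ ideal f := by
  rw [mem_ideal_iff hprime]
  intro z hz
  -- On the line `t ↦ tz` the polynomial `f i` vanishes identically. Its derivative at `t = 1` is
  -- Euler's expression.
  let ζ : Fin n → Polynomial ℂ := fun j => Polynomial.C (z j) * Polynomial.X
  have h0 : aeval ζ (f i) = 0 := by
    refine Polynomial.funext fun t => ?_
    have h1 : ((Polynomial.aeval t).comp (aeval ζ)) = aeval (R := ℂ) (t • z) := by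
      refine MvPolynomial.algHom_ext fun j => ?_
      simp only [AlgHom.comp_apply, aeval_X, map_mul, ζ, Polynomial.aeval_C, Polynomial.aeval_X,
        Pi.smul_apply, smul_eq_mul, Algebra.algebraMap_self, RingHom.id_apply]
      exact mul_comm _ _
    have h2 := DFunLike.congr_fun h1 (f i)
    rw [mem_variety_iff.1 (hcone t z hz) i] at h2
    simpa [Polynomial.coe_aeval_eq_eval] using h2
  have h1 := derivation_aeval Polynomial.derivative' ζ (f i)
  rw [h0, map_zero] at h1
  have h2 := congrArg (Polynomial.aeval (1 : ℂ)) h1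
  rw [map_zero, map_sum] at h2
  have h3 : ((Polynomial.aeval (1 : ℂ)).comp (aeval ζ)) = aeval (R := ℂ) z := by
    ext j
    simp [ζ]
  rw [map_sum, h2]
  refine Finset.sum_congr rfl fun j _ => ?_
  rw [map_mul, map_mul, ← AlgHom.comp_apply, h3, aeval_X, mul_comm]
  simp [ζ, jacobian]

theorem dotProduct_vecMul_jacobian_eq_zero (hprime : (ideal f).IsPrime)
    (hcone : ∀ (a : ℂ), ∀ z ∈ variety f, a • z ∈ variety f) {S : Type*} [CommRing S] [Algebra ℂ S]
    {z : Fin n → S} (hz : ∀ p ∈ ideal f, aeval z p = 0) (ℓ : Fin s → S) :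
    z ⬝ᵥ Matrix.vecMul ℓ (jacobianAt f z) = 0 := by
  have h : ∀ i, ∑ j, z j * jacobianAt f z i j = 0 := fun i => by
    have := hz _ (euler_mem_ideal hprime hcone i)
    simpa [jacobianAt] using this
  rw [dotProduct_comm, ← Matrix.dotProduct_mulVec]
  have h2 : (jacobianAt f z).mulVec z = 0 := by
    funext i
    rw [Matrix.mulVec, dotProduct_comm]
    exact h i
  rw [h2, dotProduct_zero]

/-- The dual variety is the closure of the projection of the conormal variety to `y`. Conormal
vectors at points where a chosen minor `δ` vanishes do no harm: `δ p` vanishes on all conormal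
pairs, and `δ` lies outside the prime conormal ideal. -/
theorem mem_ideal_dual (hprime : (ideal f).IsPrime)
    (hg : ideal g = vanishingIdeal ℂ (dualVariety f)) {p : MvPolynomial (Fin n) ℂ} :
    p ∈ ideal g ↔ inclRight p ∈ conormalVanishing f := by
  have hg' : ideal g = vanishingIdeal ℂ
      {y : Fin n → ℂ | ∃ z ∈ regularLocus f, ∀ x ∈ tangentSpace f z, y ⬝ᵥ x = 0} := by
    rw [hg, dualVariety]
    exact (zeroLocus_vanishingIdeal_galoisConnection (k := ℂ) (K := ℂ)).u_l_u_eq_u _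
  have hJ : ∀ z : Fin n → ℂ, (jacobian f).map (eval z) = jacobianAt f z := fun z => by
    ext i j
    simp [jacobianAt, aeval_eq_eval]
  rw [hg']
  constructor
  · intro hp
    obtain ⟨⟨a, b, hδ⟩, -⟩ := hasGenericRank_codim hprime
    have := isPrime_conormalVanishing hprime
    refine (this.mem_or_mem (x := inclLeft ((jacobian f).submatrix a b).det) ?_).resolve_left
      (fun h => hδ ((inclLeft_mem_conormalVanishing hprime).1 h))
    rw [mem_conormalVanishing]
    intro z hz ℓ
    rw [map_mul, aeval_inclLeft, aeval_inclRight]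
    by_cases h0 : aeval z ((jacobian f).submatrix a b).det = 0
    · rw [h0, zero_mul]
    · rw [hp _ ⟨z, ⟨hz, fun h => h0 (h _ ?_)⟩, fun x hx => ?_⟩, mul_zero]
      · exact Ideal.mem_sup_right (Ideal.subset_span ⟨a, b, rfl⟩)
      · rw [tangentSpace, LinearMap.mem_ker, Matrix.mulVecLin_apply, hJ] at hx
        rw [← Matrix.dotProduct_mulVec, hx, dotProduct_zero]
  · rintro hp y ⟨z, hz, hy⟩
    obtain ⟨ℓ, rfl⟩ := exists_vecMul_of_orthogonal_ker (jacobianAt f z) (y := y) (fun x hx => by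
      refine hy x ?_
      rw [tangentSpace, LinearMap.mem_ker, Matrix.mulVecLin_apply, hJ]
      exact hx)
    have := (mem_conormalVanishing f).1 hp z hz.1 ℓ
    rwa [aeval_inclRight] at this

theorem isPrime_ideal_dual (hprime : (ideal f).IsPrime)
    (hg : ideal g = vanishingIdeal ℂ (dualVariety f)) : (ideal g).IsPrime := by
  have := isPrime_conormalVanishing hprime
  have h : ideal g = Ideal.comap (inclRight (σ := Fin n)) (conormalVanishing f) := by
    ext p
    exact mem_ideal_dual hprime hg
  rw [h]
  exact Ideal.comap_isPrime _ _

/-- At a generic conormal pair `(z, y)` the vector `y` is generic on the dual variety. It suffices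
that `z` is normal to the dual variety at `y`; then `(y, z)` satisfies every conormal equation of
the dual. -/
theorem conormalVanishing_dual_le (hprime : (ideal f).IsPrime)
    (hcone : ∀ (a : ℂ), ∀ z ∈ variety f, a • z ∈ variety f)
    (hg : ideal g = vanishingIdeal ℂ (dualVariety f)) :
    conormalVanishing g ≤
      Ideal.comap (rename Sum.swap : _ →ₐ[ℂ] MvPolynomial (Fin n ⊕ Fin n) ℂ)
        (conormalVanishing f) := by
  obtain ⟨L, _, _, _, z, ℓ, hz, hgen⟩ := exists_generic_conormal hprime
  set y := Matrix.vecMul ℓ (jacobianAt f z) with hy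
  have hyg : ∀ p, aeval y p = 0 ↔ p ∈ ideal g := fun p => by
    rw [mem_ideal_dual hprime hg, ← hgen, aeval_inclRight]
  -- Differentiating `⟨z, y⟩ = 0` gives `⟨Dz, y⟩ + ⟨z, Dy⟩ = 0`, and the first term vanishes since
  -- `Dz` is tangent to `X` and `y` is normal.
  have horth : ∀ D : Derivation ℂ L L, z ⬝ᵥ (fun j => D (y j)) = 0 := by
    intro D
    have h1 : z ⬝ᵥ y = 0 :=
      dotProduct_vecMul_jacobian_eq_zero hprime hcone (fun p hp => (hz p).2 hp) ℓ
    have h2 : y ⬝ᵥ (fun j => D (z j)) = 0 := by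
      rw [hy, ← Matrix.dotProduct_mulVec]
      have : (jacobianAt f z).mulVec (fun j => D (z j)) = 0 := by
        funext i
        have h := derivation_aeval D z (f i)
        rw [(hz _).2 (Ideal.subset_span ⟨i, rfl⟩), map_zero] at h
        exact h.symm
      rw [this, dotProduct_zero]
    have h3 := congrArg D h1
    simp only [dotProduct, map_sum, Derivation.leibniz, smul_eq_mul, Finset.sum_add_distrib,
      map_zero] at h3 h2 ⊢
    rwa [h2, add_zero] at h3
  -- Every tangent vector of the dual variety at `y` has the form `Dy`, so `horth` makes `z`
  -- orthogonal to the whole tangent space.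
  obtain ⟨m, hm⟩ := exists_vecMul_of_orthogonal_ker (jacobianAt g y) (y := z) (fun a ha => by
    obtain ⟨D, hD⟩ := exists_derivation_of_tangent hyg
      (tangent_of_generators g (fun p hp => (hyg p).2 hp) (fun i => congrFun ha i))
    rw [← horth D]
    exact congrArg _ (funext fun j => (hD j).symm))
  intro h hh
  have hswap : Sum.elim z y ∘ Sum.swap = Sum.elim y z := by
    funext i
    cases i <;> rfl
  rw [Ideal.mem_comap, ← hgen, aeval_rename, hswap]
  have h1 := aeval_eq_zero_of_mem_conormalVanishing (isPrime_ideal_dual hprime hg)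
    (fun i => (hyg _).2 (Ideal.subset_span ⟨i, rfl⟩)) m hh
  rwa [← hm] at h1

end Duality

end HermitianDistance

namespace HermitianDistance

open MvPolynomial

/-! ### Transcendence degrees of quotients and compositums. -/

section Transcendence

/-- Nested primes with quotients of the same finite transcendence degree are equal. -/
theorem eq_of_le_of_trdeg_le {R : Type} [CommRing R] [Algebra ℂ R] {P Q : Ideal R} (hP : P.IsPrime)
    (hQ : Q.IsPrime) (h : P ≤ Q) (hfin : Algebra.trdeg ℂ (R ⧸ P) < Cardinal.aleph0)
    (hle : Algebra.trdeg ℂ (R ⧸ P) ≤ Algebra.trdeg ℂ (R ⧸ Q)) : P = Q := by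
  let π : (R ⧸ P) →ₐ[ℂ] (R ⧸ Q) := Ideal.Quotient.factorₐ ℂ h
  have hπ : Function.Surjective π := Ideal.Quotient.factor_surjective h
  obtain ⟨S, hS⟩ := exists_isTranscendenceBasis ℂ (R ⧸ Q)
  choose r hr using fun x : S => hπ x
  have hind : AlgebraicIndependent ℂ r := by
    refine AlgebraicIndependent.of_comp π ?_
    convert hS.1 using 1
    exact funext hr
  have hr' : IsTranscendenceBasis ℂ r :=
    hind.isTranscendenceBasis_of_trdeg_le hfin (hle.trans_eq hS.cardinalMk_eq_trdeg.symm)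
  refine le_antisymm h fun x hx => ?_
  by_contra hxP
  have halg := hr'.isAlgebraic
  have hx0 : (Ideal.Quotient.mk P x) ≠ 0 := by rwa [Ne, Ideal.Quotient.eq_zero_iff_mem]
  -- The lifted basis `r` of `R ⧸ Q` is still a transcendence basis of `R ⧸ P`, so an `x` in `Q`
  -- outside `P` satisfies an equation over it with nonzero constant term. Modulo `Q` that term
  -- becomes an algebraic relation between the original basis elements.
  obtain ⟨p, hp0, hp⟩ := (halg.isAlgebraic (Ideal.Quotient.mk P x)).exists_nonzero_coeff_and_aeval_eq_zero
    (mem_nonZeroDivisors_of_ne_zero hx0)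
  have h1 : π (Ideal.Quotient.mk P x) = 0 := (Ideal.Quotient.eq_zero_iff_mem).2 hx
  have h2 : π (p.coeff 0 : R ⧸ P) = 0 := by
    have h3 := congrArg π hp
    rw [Polynomial.aeval_eq_sum_range, map_sum, map_zero, Finset.sum_eq_single 0] at h3
    · simpa [Algebra.smul_def] using h3
    · intro i _ hi
      rw [Algebra.smul_def, map_mul, map_pow, h1, zero_pow hi, mul_zero]
    · simp
  have h4 : ((p.coeff 0 : Algebra.adjoin ℂ (Set.range r)) : R ⧸ P) ∈ (aeval (R := ℂ) r).range := by
    rw [← Algebra.adjoin_range_eq_range_aeval]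
    exact (p.coeff 0).2
  obtain ⟨q, hq⟩ := h4
  have h5 : aeval (fun x : S => (x : R ⧸ Q)) q = 0 := by
    have : π.comp (aeval (R := ℂ) r) = aeval (fun x : S => (x : R ⧸ Q)) := by
      ext x
      simp [hr]
    rw [← this, AlgHom.comp_apply]
    exact (congrArg π hq).trans h2
  have h6 : q = 0 := hS.1 (by rw [h5, map_zero])
  rw [h6] at hq
  exact hp0 (Subtype.ext (hq.symm.trans (map_zero _)))

/-- The transcendence degree of a domain generated by two subalgebras. -/
theorem trdeg_le_add {D B B' : Type} [CommRing D] [IsDomain D] [CommRing B] [IsDomain B]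
    [CommRing B'] [IsDomain B'] [Algebra ℂ D] [Algebra ℂ B] [Algebra ℂ B'] (φ : B →ₐ[ℂ] D)
    (φ' : B' →ₐ[ℂ] D) (hφ : Function.Injective φ) (hφ' : Function.Injective φ')
    (h : Algebra.adjoin ℂ (Set.range φ ∪ Set.range φ') = ⊤) :
    Algebra.trdeg ℂ D ≤ Algebra.trdeg ℂ B + Algebra.trdeg ℂ B' := by
  obtain ⟨S, hS⟩ := exists_isTranscendenceBasis ℂ B
  obtain ⟨S', hS'⟩ := exists_isTranscendenceBasis ℂ B'
  let U : Set D := φ '' S ∪ φ' '' S'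
  -- Algebraic equations over a basis of either factor are carried into `D`; injectivity of `ψ`
  -- keeps them nontrivial.
  have aux : ∀ {E : Type} [CommRing E] [IsDomain E] [Algebra ℂ E] (ψ : E →ₐ[ℂ] D)
      (_ : Function.Injective ψ) {V : Set E} (_ : IsTranscendenceBasis ℂ ((↑) : V → E))
      (_ : ψ '' V ⊆ U) (x : E), IsAlgebraic (Algebra.adjoin ℂ U) (ψ x) := by
    intro E _ _ _ ψ hψ V hV hVU x
    have halg := hV.isAlgebraic
    rw [Subtype.range_coe] at halg
    have hmem : ∀ y ∈ Algebra.adjoin ℂ V, ψ y ∈ Algebra.adjoin ℂ U := by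
      intro y hy
      have : ψ y ∈ (Algebra.adjoin ℂ V).map ψ := ⟨y, hy, rfl⟩
      rw [AlgHom.map_adjoin] at this
      exact Algebra.adjoin_mono hVU this
    let χ : Algebra.adjoin ℂ V →+* Algebra.adjoin ℂ U :=
      ((ψ.comp (Algebra.adjoin ℂ V).val).codRestrict (Algebra.adjoin ℂ U)
        (fun y => hmem y y.2)).toRingHom
    have hχ : Function.Injective χ := fun y y' hyy => Subtype.ext (hψ (congrArg Subtype.val hyy))
    exact (halg.isAlgebraic x).ringHom_of_comp_eq χ ψ.toRingHom hχ (by ext; rfl)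
  have : Algebra.IsAlgebraic (Algebra.adjoin ℂ U) D := by
    refine ⟨fun x => ?_⟩
    have hx : x ∈ Algebra.adjoin ℂ (Set.range φ ∪ Set.range φ') := h ▸ Algebra.mem_top
    induction hx using Algebra.adjoin_induction with
    | mem x hx =>
      rcases hx with ⟨b, rfl⟩ | ⟨b, rfl⟩
      · exact aux φ hφ hS Set.subset_union_left b
      · exact aux φ' hφ' hS' Set.subset_union_right b
    | algebraMap c => exact isAlgebraic_algebraMap (algebraMap ℂ (Algebra.adjoin ℂ U) c)
    | add x y _ _ hx hy => exact hx.add hy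
    | mul x y _ _ hx hy => exact hx.mul hy
  refine (Algebra.IsAlgebraic.trdeg_le_cardinalMk ℂ U).trans ?_
  refine (Cardinal.mk_union_le _ _).trans (add_le_add ?_ ?_)
  · exact Cardinal.mk_image_le.trans hS.cardinalMk_eq_trdeg.le
  · exact Cardinal.mk_image_le.trans hS'.cardinalMk_eq_trdeg.le

/-- The form of `eq_vecMul_of_minors_eq_zero` with the denominator cleared: the minor need only be
nonzero, and the inverse taken in the fraction field becomes the adjugate. -/
theorem det_mul_eq_of_minors {S ρ κ : Type*} [CommRing S] [IsDomain S] {J : Matrix ρ κ S}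
    {y : κ → S} {c : ℕ} {a : Fin c → ρ} {b : Fin c → κ} (hu : (J.submatrix a b).det ≠ 0)
    (h : ∀ j, ((Matrix.of (Fin.cons y fun i => J (a i)) : Matrix (Fin (c + 1)) κ S).submatrix id
      (Fin.cons j b : Fin (c + 1) → κ)).det = 0) (j : κ) :
    (J.submatrix a b).det * y j =
      Matrix.vecMul (Matrix.vecMul (y ∘ b) (J.submatrix a b).adjugate) (J.submatrix a id) j := by
  let φ := algebraMap S (FractionRing S)
  have hφ : Function.Injective φ := IsFractionRing.injective S (FractionRing S)
  have hdet : ((J.map φ).submatrix a b).det = φ (J.submatrix a b).det := (RingHom.map_det φ _).symm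
  have hadj : ((J.map φ).submatrix a b).adjugate = (J.submatrix a b).adjugate.map φ :=
    (RingHom.map_adjugate φ _).symm
  have hne : φ (J.submatrix a b).det ≠ 0 := by rwa [Ne, map_eq_zero_iff φ hφ]
  have h1 := eq_vecMul_of_minors_eq_zero (J := J.map φ) (y := φ ∘ y) (a := a) (b := b)
    (by rw [hdet]; exact isUnit_iff_ne_zero.2 hne) (fun j => by
      rw [← map_zero φ, ← h j, RingHom.map_det]
      congr 1
      ext x z
      refine Fin.cases ?_ (fun x => ?_) x <;> simp)
  have h2 := congrFun h1 j
  rw [Matrix.inv_def, hdet, hadj, Ring.inverse_eq_inv', Matrix.vecMul_smul, Matrix.smul_vecMul,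
    Pi.smul_apply, smul_eq_mul, eq_inv_mul_iff_mul_eq₀ hne] at h2
  apply hφ
  rw [map_mul]
  refine h2.trans ?_
  simp [Matrix.vecMul, dotProduct, map_sum]

end Transcendence

end HermitianDistance

namespace HermitianDistance

open MvPolynomial

/-! ### The dimension of the conormal variety, and biduality. -/

section Dimension

variable {n s : ℕ} {f : Fin s → MvPolynomial (Fin n) ℂ}

/-- Over the function field of `X` the fibre is the row space, of dimension `c = codim f`, so the
total is `(n - c) + c`. The `c` coordinates of `y` in the columns of a nonzero minor form a
transcendence basis: Cramer's rule expresses the others through them. -/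
theorem trdeg_conormal (hprime : (ideal f).IsPrime) :
    Algebra.trdeg ℂ (MvPolynomial (Fin n ⊕ Fin n) ℂ ⧸ conormalVanishing f) = n := by
  let A := MvPolynomial (Fin n) ℂ ⧸ ideal f
  let B := MvPolynomial (Fin n ⊕ Fin n) ℂ ⧸ conormalVanishing f
  have hcprime := isPrime_conormalVanishing hprime
  have hle : ideal f ≤ Ideal.comap (inclLeft (τ := Fin n)) (conormalVanishing f) :=
    fun p hp => (inclLeft_mem_conormalVanishing hprime).2 hp
  let ι : A →ₐ[ℂ] B := Ideal.quotientMapₐ (conormalVanishing f) inclLeft hle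
  have hιmk : ∀ p, ι (Ideal.Quotient.mk _ p) = Ideal.Quotient.mk _ (inclLeft p) := fun p => rfl
  have hι : Function.Injective ι := by
    rw [injective_iff_map_eq_zero]
    intro x hx
    obtain ⟨p, rfl⟩ := Ideal.Quotient.mk_surjective x
    rw [hιmk, Ideal.Quotient.eq_zero_iff_mem, inclLeft_mem_conormalVanishing hprime] at hx
    rwa [Ideal.Quotient.eq_zero_iff_mem]
  let _ : Algebra A B := ι.toRingHom.toAlgebra
  have hmap : ∀ x, algebraMap A B x = ι x := fun _ => rfl
  have : IsScalarTower ℂ A B := IsScalarTower.of_algebraMap_eq fun x => (ι.commutes x).symm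
  have : FaithfulSMul A B := (faithfulSMul_iff_algebraMap_injective A B).mpr hι
  have hc := hasGenericRank_codim hprime
  obtain ⟨c, hcdef⟩ : ∃ c, c = codim f := ⟨_, rfl⟩
  rw [← hcdef] at hc
  obtain ⟨⟨a, b, hδ⟩, -⟩ := id hc
  let mkB : MvPolynomial (Fin n ⊕ Fin n) ℂ →+* B := Ideal.Quotient.mk _
  let y : Fin n → B := fun j => mkB (X (Sum.inr j))
  let J : Matrix (Fin s) (Fin n) B := (jacobian f).map fun p => mkB (inclLeft p)
  have hJ : ∀ i j, J i j = algebraMap A B (Ideal.Quotient.mk _ (jacobian f i j)) :=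
    fun i j => rfl
  have hdetJ : (J.submatrix a b).det =
      algebraMap A B (Ideal.Quotient.mk _ ((jacobian f).submatrix a b).det) :=
    (RingHom.map_det ((algebraMap A B).comp (Ideal.Quotient.mk _)) _).symm
  have hdet0 : (J.submatrix a b).det ≠ 0 := by
    rw [hdetJ, hmap, Ne, map_eq_zero_iff ι hι, Ideal.Quotient.eq_zero_iff_mem]
    exact hδ
  have hrel := det_mul_eq_of_minors (y := y) hdet0 (fun j => by
    have h1 := hc.minor_mem hprime (Fin.cons 0 fun i => (a i).succ) (Fin.cons j b)
    rw [← Ideal.Quotient.eq_zero_iff_mem] at h1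
    refine Eq.trans ?_ h1
    rw [RingHom.map_det]
    congr 1
    ext x z
    refine Fin.cases ?_ (fun x => ?_) x <;> rfl)
  -- the `y b` generate up to algebraic elements
  let yb : Fin c → B := fun i => y (b i)
  have halg : Algebra.IsAlgebraic (Algebra.adjoin A (Set.range yb)) B := by
    let T := Algebra.adjoin A (Set.range yb)
    have hA : ∀ x : A, IsAlgebraic T (algebraMap A B x) := fun x =>
      isAlgebraic_algebraMap (algebraMap A T x)
    have hsum : ∀ {κ : Type} (t : Finset κ) (h : κ → B), (∀ i, IsAlgebraic T (h i)) →
        IsAlgebraic T (∑ i ∈ t, h i) := fun t h hh => by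
      have h1 : ∑ i ∈ t, h i ∈ Subalgebra.algebraicClosure T B :=
        Subalgebra.sum_mem _ fun i _ => hh i
      exact h1
    have hy : ∀ j, IsAlgebraic T (y j) := fun j => by
      refine IsAlgebraic.of_mul (mem_nonZeroDivisors_of_ne_zero hdet0) ?_ ?_
      · rw [hdetJ]
        exact hA _
      · rw [hrel]
        simp only [Matrix.vecMul, dotProduct]
        refine hsum _ _ fun i => (hsum _ _ fun k => ?_).mul
          (by rw [Matrix.submatrix_apply, hJ]; exact hA _)
        refine IsAlgebraic.mul ?_ ?_
        · exact isAlgebraic_algebraMap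
            (⟨yb k, Algebra.subset_adjoin ⟨k, rfl⟩⟩ : Algebra.adjoin A (Set.range yb))
        · have : (J.submatrix a b).adjugate = ((jacobian f).submatrix a b).adjugate.map
              ((algebraMap A B).comp (Ideal.Quotient.mk _)) :=
            (RingHom.map_adjugate ((algebraMap A B).comp (Ideal.Quotient.mk _)) _).symm
          rw [this, Matrix.map_apply, RingHom.comp_apply]
          exact hA _
    refine ⟨fun x => ?_⟩
    obtain ⟨p, rfl⟩ := Ideal.Quotient.mk_surjective x
    induction p using MvPolynomial.induction_on with
    | C r =>
      have := hA (algebraMap ℂ A r)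
      rwa [← IsScalarTower.algebraMap_apply ℂ A B] at this
    | add p q hp hq => rw [map_add]; exact hp.add hq
    | mul_X p i hp =>
      rw [map_mul]
      refine hp.mul ?_
      cases i with
      | inl i =>
        have := hA (Ideal.Quotient.mk _ (X i))
        rw [hmap, hιmk] at this
        simpa [inclLeft] using this
      | inr i => exact hy i
  -- the `y b` are independent
  have hind : AlgebraicIndependent A yb := by
    let K := FractionRing A
    let S := MvPolynomial (Fin c) K
    let φ : A →+* S := C.comp (algebraMap A K)
    let z : Fin n → S := fun j => φ (Ideal.Quotient.mk _ (X j))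
    have hz : ∀ p, aeval z p = φ (Ideal.Quotient.mk _ p) := by
      intro p
      have : (aeval z : MvPolynomial (Fin n) ℂ →ₐ[ℂ] S) =
          ((IsScalarTower.toAlgHom ℂ K S).comp (IsScalarTower.toAlgHom ℂ A K)).comp
            (Ideal.Quotient.mkₐ ℂ (ideal f)) := by
        refine MvPolynomial.algHom_ext fun j => ?_
        rw [aeval_X]
        rfl
      rw [this]
      rfl
    let JS := jacobianAt f z
    have hu : IsUnit (JS.submatrix a b).det := by
      have h1 : (JS.submatrix a b).det = aeval z ((jacobian f).submatrix a b).det :=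
        (AlgHom.map_det (aeval z) _).symm
      rw [h1, hz]
      refine IsUnit.map C (isUnit_iff_ne_zero.2 ?_)
      rw [Ne, map_eq_zero_iff _ (IsFractionRing.injective A K), Ideal.Quotient.eq_zero_iff_mem]
      exact hδ
    -- The multiplier is chosen so that the conormal vector over `K[X₁, …, X_c]` has the
    -- indeterminates as its `b`-coordinates, which proves their independence.
    let m : Fin c → S := Matrix.vecMul X (JS.submatrix a b)⁻¹
    let ℓ : Fin s → S := Matrix.vecMul m ((1 : Matrix (Fin s) (Fin s) S).submatrix a id)
    have hℓ : Matrix.vecMul ℓ JS = Matrix.vecMul m (JS.submatrix a id) := by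
      rw [Matrix.vecMul_vecMul]
      congr 1
      ext i j
      simp [Matrix.mul_apply, Matrix.one_apply]
    have hker : ∀ h ∈ conormalVanishing f, aeval (Sum.elim z (Matrix.vecMul ℓ JS)) h = 0 :=
      fun h hh => aeval_eq_zero_of_mem_conormalVanishing hprime (fun i => by
        have hi : f i ∈ ideal f := Ideal.subset_span ⟨i, rfl⟩
        rw [hz, Ideal.Quotient.eq_zero_iff_mem.2 hi, map_zero]) ℓ hh
    let ψ : B →+* S := Ideal.Quotient.lift _
      (aeval (Sum.elim z (Matrix.vecMul ℓ JS)) : _ →ₐ[ℂ] S).toRingHom hker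
    have hψA : ∀ x : A, ψ (algebraMap A B x) = φ x := by
      intro x
      obtain ⟨p, rfl⟩ := Ideal.Quotient.mk_surjective x
      rw [hmap, hιmk]
      change aeval (Sum.elim z (Matrix.vecMul ℓ JS)) (inclLeft p) = _
      rw [aeval_inclLeft, hz]
    have hψy : ∀ i, ψ (yb i) = X i := by
      intro i
      change aeval (Sum.elim z (Matrix.vecMul ℓ JS)) (X (Sum.inr (b i))) = _
      rw [aeval_X, Sum.elim_inr, hℓ]
      have h1 : Matrix.vecMul m (JS.submatrix a b) = X := by
        rw [Matrix.vecMul_vecMul, Matrix.nonsing_inv_mul _ hu, Matrix.vecMul_one]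
      exact congrFun h1 i
    rw [algebraicIndependent_iff]
    intro p hp
    have h1 : ψ (aeval yb p) = map (algebraMap A K) p := by
      rw [aeval_def, hom_eval₂]
      have e1 : ψ.comp (algebraMap A B) = C.comp (algebraMap A K) := RingHom.ext hψA
      have e2 : (fun i => ψ (yb i)) = X := funext hψy
      rw [e1, e2]
      clear hp
      induction p using MvPolynomial.induction_on with
      | C x => simp
      | add p q hp hq => rw [eval₂_add, hp, hq, map_add]
      | mul_X p i hp => rw [eval₂_mul, hp, eval₂_X, map_mul, map_X]
    rw [hp, map_zero] at h1
    exact (map_injective _ (IsFractionRing.injective A K)) (h1.symm.trans (map_zero _).symm)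
  have hbasis : IsTranscendenceBasis A yb := hind.isTranscendenceBasis_iff_isAlgebraic.2 halg
  have h1 : Algebra.trdeg A B = c := by
    have := hbasis.cardinalMk_eq_trdeg
    simpa using this.symm
  have hAle := trdeg_coordinateRing_le (ideal f)
  change Algebra.trdeg ℂ B = n
  rw [← trdeg_add_eq ℂ A (A := B), h1]
  obtain ⟨d, hd⟩ := Cardinal.lt_aleph0.1 (hAle.trans_lt (Cardinal.natCast_lt_aleph0))
  have hd' : Algebra.trdeg ℂ A = d := hd
  have hcn : c = n - d := by rw [hcdef, codim, hd, Cardinal.toNat_natCast]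
  rw [hd] at hAle
  rw [hd', hcn, ← Nat.cast_add, Nat.add_sub_cancel' (by exact_mod_cast hAle)]

/-- Biduality. Both ideals are prime, one contains the other, and both quotients have dimension `n`,
because `trdeg_conormal` applies to `X` and to its dual alike. -/
theorem conormalVanishing_dual {r : ℕ} {g : Fin r → MvPolynomial (Fin n) ℂ}
    (hprime : (ideal f).IsPrime) (hcone : ∀ (a : ℂ), ∀ z ∈ variety f, a • z ∈ variety f)
    (hg : ideal g = vanishingIdeal ℂ (dualVariety f)) :
    conormalVanishing g =
      Ideal.comap (rename Sum.swap : _ →ₐ[ℂ] MvPolynomial (Fin n ⊕ Fin n) ℂ)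
        (conormalVanishing f) := by
  have hgp := isPrime_ideal_dual hprime hg
  have h1 := isPrime_conormalVanishing hprime
  have hn := trdeg_conormal hgp
  refine eq_of_le_of_trdeg_le (isPrime_conormalVanishing hgp) (Ideal.comap_isPrime _ _)
    (conormalVanishing_dual_le hprime hcone hg) ?_ ?_
  · rw [hn]
    exact Cardinal.natCast_lt_aleph0
  · rw [hn, ← trdeg_conormal hprime]
    let σ : MvPolynomial (Fin n ⊕ Fin n) ℂ →ₐ[ℂ] MvPolynomial (Fin n ⊕ Fin n) ℂ :=
      rename Sum.swap
    have hσ : Function.Surjective σ := rename_surjective _ Sum.swap_rightInverse.surjective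
    let e : (MvPolynomial (Fin n ⊕ Fin n) ℂ ⧸ Ideal.comap σ (conormalVanishing f)) →ₐ[ℂ]
      (MvPolynomial (Fin n ⊕ Fin n) ℂ ⧸ conormalVanishing f) :=
      Ideal.quotientMapₐ (conormalVanishing f) σ le_rfl
    exact trdeg_le_of_surjective e (Ideal.quotientMap_surjective (H := le_rfl) hσ)

end Dimension

end HermitianDistance

namespace HermitianDistance

open MvPolynomial

/-! ### The conjugate variety. -/

section Conjugation

/-- Conjugation of the coefficients. -/
noncomputable def conjCoeff {σ : Type*} : MvPolynomial σ ℂ →+* MvPolynomial σ ℂ :=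
  map (starRingEnd ℂ)

theorem conjCoeff_conjCoeff {σ : Type*} (p : MvPolynomial σ ℂ) : conjCoeff (conjCoeff p) = p := by
  have h : (starRingEnd ℂ).comp (starRingEnd ℂ) = RingHom.id ℂ := by
    ext
    simp
  rw [conjCoeff, map_map, h, map_id]

theorem aeval_conjCoeff {σ : Type*} (x : σ → ℂ) (p : MvPolynomial σ ℂ) :
    aeval (fun i => starRingEnd ℂ (x i)) (conjCoeff p) = starRingEnd ℂ (aeval x p) := by
  induction p using MvPolynomial.induction_on with
  | C a => simp [conjCoeff]
  | add p q hp hq => simp only [map_add, hp, hq]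
  | mul_X p i hp =>
    have hX : conjCoeff (X i : MvPolynomial σ ℂ) = X i := map_X _ _
    simp only [map_mul, hp, aeval_X, hX]

variable {n s : ℕ} (f : Fin s → MvPolynomial (Fin n) ℂ)

/-- The equations of the conjugate variety. -/
noncomputable def conjFamily : Fin s → MvPolynomial (Fin n) ℂ := fun i => conjCoeff (f i)

theorem conjFamily_conjFamily : conjFamily (conjFamily f) = f :=
  funext fun i => conjCoeff_conjCoeff (f i)

theorem conjCoeff_mem_ideal_conjFamily {p : MvPolynomial (Fin n) ℂ} (hp : p ∈ ideal f) :
    conjCoeff p ∈ ideal (conjFamily f) := by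
  have : ideal f ≤ (ideal (conjFamily f)).comap conjCoeff := by
    refine Ideal.span_le.2 ?_
    rintro _ ⟨i, rfl⟩
    exact Ideal.subset_span ⟨i, rfl⟩
  exact this hp

theorem mem_ideal_conjFamily {p : MvPolynomial (Fin n) ℂ} :
    p ∈ ideal (conjFamily f) ↔ conjCoeff p ∈ ideal f := by
  refine ⟨fun h => ?_, fun h => ?_⟩
  · have := conjCoeff_mem_ideal_conjFamily (conjFamily f) h
    rwa [conjFamily_conjFamily] at this
  · have := conjCoeff_mem_ideal_conjFamily f h
    rwa [conjCoeff_conjCoeff] at this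

theorem isPrime_ideal_conjFamily (hprime : (ideal f).IsPrime) :
    (ideal (conjFamily f)).IsPrime := by
  have h : ideal (conjFamily f) = (ideal f).comap conjCoeff := by
    ext p
    exact mem_ideal_conjFamily f
  rw [h]
  exact Ideal.comap_isPrime _ _

theorem mem_variety_conjFamily {z : Fin n → ℂ} :
    z ∈ variety (conjFamily f) ↔ (fun i => starRingEnd ℂ (z i)) ∈ variety f := by
  rw [mem_variety_iff, mem_variety_iff]
  refine forall_congr' fun i => ?_
  rw [← map_eq_zero (starRingEnd ℂ), ← aeval_conjCoeff]
  simp only [conjFamily, conjCoeff_conjCoeff]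

theorem jacobian_conjFamily (i : Fin s) (j : Fin n) :
    jacobian (conjFamily f) i j = conjCoeff (jacobian f i j) := by
  simp [jacobian, conjFamily, conjCoeff, pderiv_map]

theorem jacobianAt_conjFamily (z : Fin n → ℂ) (i : Fin s) (j : Fin n) :
    jacobianAt (conjFamily f) (fun i => starRingEnd ℂ (z i)) i j =
      starRingEnd ℂ (jacobianAt f z i j) := by
  simp only [jacobianAt, Matrix.map_apply, jacobian_conjFamily, aeval_conjCoeff]

theorem det_jacobian_conjFamily {k : ℕ} (a : Fin k → Fin s) (b : Fin k → Fin n) :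
    ((jacobian (conjFamily f)).submatrix a b).det = conjCoeff ((jacobian f).submatrix a b).det := by
  rw [RingHom.map_det]
  congr 1
  ext1 i j
  exact jacobian_conjFamily f _ _

variable {f}

theorem HasGenericRank.conjFamily {c : ℕ} (hc : HasGenericRank f c) :
    HasGenericRank (conjFamily f) c := by
  obtain ⟨⟨a, b, h⟩, h'⟩ := hc
  refine ⟨⟨a, b, ?_⟩, fun a b => ?_⟩
  · rwa [det_jacobian_conjFamily, mem_ideal_conjFamily, conjCoeff_conjCoeff]
  · rw [det_jacobian_conjFamily, mem_ideal_conjFamily, conjCoeff_conjCoeff]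
    exact h' a b

theorem cone_conjFamily (hcone : ∀ (a : ℂ), ∀ z ∈ variety f, a • z ∈ variety f) (a : ℂ) :
    ∀ z ∈ variety (conjFamily f), a • z ∈ variety (conjFamily f) := by
  intro z hz
  rw [mem_variety_conjFamily] at hz ⊢
  have := hcone (starRingEnd ℂ a) _ hz
  convert this using 1
  funext i
  simp

variable (f) in
theorem conjCoeff_mem_conormalVanishing {h : MvPolynomial (Fin n ⊕ Fin n) ℂ}
    (hh : h ∈ conormalVanishing f) : conjCoeff h ∈ conormalVanishing (conjFamily f) := by
  rw [mem_conormalVanishing] at hh ⊢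
  intro z hz ℓ
  have h1 := hh _ ((mem_variety_conjFamily f).1 hz) (fun i => starRingEnd ℂ (ℓ i))
  rw [← map_eq_zero (starRingEnd ℂ), ← aeval_conjCoeff] at h1
  convert h1 using 3
  funext i
  cases i with
  | inl i => simp
  | inr i =>
    have := fun k j => jacobianAt_conjFamily f (fun i => starRingEnd ℂ (z i)) k j
    simp only [RingHomCompTriple.comp_apply, RingHom.id_apply] at this
    simp [Matrix.vecMul, dotProduct, this]

theorem mem_conormalVanishing_conjFamily {h : MvPolynomial (Fin n ⊕ Fin n) ℂ} :
    h ∈ conormalVanishing (conjFamily f) ↔ conjCoeff h ∈ conormalVanishing f := by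
  refine ⟨fun h => ?_, fun h => ?_⟩
  · have := conjCoeff_mem_conormalVanishing (conjFamily f) h
    rwa [conjFamily_conjFamily] at this
  · have := conjCoeff_mem_conormalVanishing f h
    rwa [conjCoeff_conjCoeff] at this

end Conjugation

/-! ### The critical ideal as the ideal of pairs of conormal vectors. -/

section Critical

/-- The change of coordinates `u = z + x`, `v = w + y` on `ℂ[z, w, u, v]`. -/
noncomputable def toConormalPairs (n : ℕ) :
    HRing n →ₐ[ℂ] MvPolynomial ((Fin n ⊕ Fin n) ⊕ (Fin n ⊕ Fin n)) ℂ :=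
  aeval fun i => match i with
    | .z i => X (Sum.inl (Sum.inl i))
    | .w i => X (Sum.inr (Sum.inl i))
    | .u i => X (Sum.inl (Sum.inl i)) + X (Sum.inr (Sum.inr i))
    | .v i => X (Sum.inr (Sum.inl i)) + X (Sum.inl (Sum.inr i))

/-- The point of `z, w, u, v`-space with `u = z + x`, `v = w + y`. -/
def hermitianPoint {n : ℕ} {S : Type*} [Add S] (z y w x : Fin n → S) : HVar n → S
  | .z i => z i
  | .w i => w i
  | .u i => z i + x i
  | .v i => w i + y i

theorem aeval_toConormalPairs {n : ℕ} {S : Type*} [CommRing S] [Algebra ℂ S]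
    (z y w x : Fin n → S) (p : HRing n) :
    aeval (Sum.elim (Sum.elim z y) (Sum.elim w x)) (toConormalPairs n p) =
      aeval (hermitianPoint z y w x) p := by
  have : (aeval (Sum.elim (Sum.elim z y) (Sum.elim w x))).comp (toConormalPairs n) =
      aeval (R := ℂ) (hermitianPoint z y w x) := by
    ext i
    cases i <;> simp [toConormalPairs, hermitianPoint]
  exact DFunLike.congr_fun this p

variable {n s : ℕ} (f : Fin s → MvPolynomial (Fin n) ℂ)

/-- The vanishing ideal of the product of the conormal variety with its conjugate. -/
noncomputable def conormalPairsVanishing :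
    Ideal (MvPolynomial ((Fin n ⊕ Fin n) ⊕ (Fin n ⊕ Fin n)) ℂ) :=
  vanishingIdeal ℂ (prodSet (conormalSet f) (conormalSet (conjFamily f)))

theorem isPrime_conormalPairsVanishing (hprime : (ideal f).IsPrime) :
    (conormalPairsVanishing f).IsPrime :=
  isPrime_vanishingIdeal_prodSet (isPrime_conormalVanishing hprime)
    (isPrime_conormalVanishing (isPrime_ideal_conjFamily f hprime))

variable {f}

theorem conormalSet_nonempty (hprime : (ideal f).IsPrime) : (conormalSet f).Nonempty := by
  rw [Set.nonempty_iff_ne_empty]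
  intro h
  refine (isPrime_conormalVanishing hprime).ne_top ?_
  rw [conormalVanishing, h, vanishingIdeal_empty]

theorem inclLeft_mem_conormalPairsVanishing (hprime : (ideal f).IsPrime)
    {h : MvPolynomial (Fin n ⊕ Fin n) ℂ} :
    inclLeft h ∈ conormalPairsVanishing f ↔ h ∈ conormalVanishing f := by
  obtain ⟨y, hy⟩ := conormalSet_nonempty (isPrime_ideal_conjFamily f hprime)
  rw [conormalPairsVanishing, mem_vanishingIdeal_prodSet]
  simp only [aeval_inclLeft]
  exact ⟨fun h x hx => h x hx y hy, fun h x hx _ _ => h x hx⟩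

theorem inclRight_mem_conormalPairsVanishing (hprime : (ideal f).IsPrime)
    {h : MvPolynomial (Fin n ⊕ Fin n) ℂ} :
    inclRight h ∈ conormalPairsVanishing f ↔ h ∈ conormalVanishing (conjFamily f) := by
  obtain ⟨x, hx⟩ := conormalSet_nonempty hprime
  rw [conormalPairsVanishing, mem_vanishingIdeal_prodSet]
  simp only [aeval_inclRight]
  exact ⟨fun h y hy => h x hx y hy, fun h _ _ y hy => h y hy⟩

theorem toConormalPairs_inclZ (p : MvPolynomial (Fin n) ℂ) :
    toConormalPairs n (inclZ n p) = inclLeft (inclLeft p) := by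
  have h : (toConormalPairs n).comp (rename HVar.z) = (inclLeft.comp inclLeft :
      MvPolynomial (Fin n) ℂ →ₐ[ℂ] _) :=
    algHom_ext fun i => by simp [toConormalPairs, inclLeft]
  exact DFunLike.congr_fun h p

theorem starMap_inclZ (p : MvPolynomial (Fin n) ℂ) :
    starMap n (inclZ n p) = rename HVar.w (conjCoeff p) := by
  change rename HVar.conj (map (starRingEnd ℂ) (rename HVar.z p)) = _
  rw [map_rename, rename_rename]
  rfl

theorem toConormalPairs_starMap_inclZ (p : MvPolynomial (Fin n) ℂ) :
    toConormalPairs n (starMap n (inclZ n p)) = inclRight (inclLeft (conjCoeff p)) := by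
  have h : (toConormalPairs n).comp (rename HVar.w) = (inclRight.comp inclLeft :
      MvPolynomial (Fin n) ℂ →ₐ[ℂ] _) :=
    algHom_ext fun i => by simp [toConormalPairs, inclLeft, inclRight]
  rw [starMap_inclZ]
  exact DFunLike.congr_fun h _

theorem toConormalPairs_minor {k : ℕ} (a : Fin k → Fin (s + 1)) (b : Fin k → Fin n) :
    toConormalPairs n ((augmentedMatrix f).submatrix a b).det =
      inclLeft ((Matrix.of (Fin.cons (fun j => X (Sum.inr j)) fun i j => inclLeft (jacobian f i j)) :
        Matrix (Fin (s + 1)) (Fin n) (MvPolynomial (Fin n ⊕ Fin n) ℂ)).submatrix a b).det := by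
  rw [AlgHom.map_det, AlgHom.map_det]
  congr 1
  ext1 x y
  simp only [AlgHom.mapMatrix_apply, Matrix.map_apply, Matrix.submatrix_apply, augmentedMatrix,
    Matrix.of_apply]
  refine Fin.cases ?_ (fun x => ?_) (a x)
  · simp [toConormalPairs, inclLeft]
  · simp [toConormalPairs_inclZ]

theorem toConormalPairs_starMap_minor {k : ℕ} (a : Fin k → Fin (s + 1)) (b : Fin k → Fin n) :
    toConormalPairs n (starMap n ((augmentedMatrix f).submatrix a b).det) =
      inclRight ((Matrix.of (Fin.cons (fun j => X (Sum.inr j)) fun i j =>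
        inclLeft (jacobian (conjFamily f) i j)) :
        Matrix (Fin (s + 1)) (Fin n) (MvPolynomial (Fin n ⊕ Fin n) ℂ)).submatrix a b).det := by
  rw [RingHom.map_det, AlgHom.map_det, AlgHom.map_det]
  congr 1
  ext1 x y
  simp only [AlgHom.mapMatrix_apply, RingHom.mapMatrix_apply, Matrix.map_apply,
    Matrix.submatrix_apply, augmentedMatrix, Matrix.of_apply]
  refine Fin.cases ?_ (fun x => ?_) (a x)
  · simp [toConormalPairs, inclRight, starMap, HVar.conj]
  · simp [toConormalPairs_starMap_inclZ, jacobian_conjFamily]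

variable (f) in
/-- The ideal `I_X + I_X* + I'_X + I'_X*`. -/
noncomputable def unsaturatedIdeal : Ideal (HRing n) :=
  (ideal f).map (inclZ n) ⊔ ((ideal f).map (inclZ n)).map (starMap n)
    ⊔ conormalIdeal f ⊔ (conormalIdeal f).map (starMap n)

theorem unsaturatedIdeal_le (hprime : (ideal f).IsPrime) :
    unsaturatedIdeal f ≤ (conormalPairsVanishing f).comap (toConormalPairs n) := by
  have hc := hasGenericRank_codim hprime
  have hprime' := isPrime_ideal_conjFamily f hprime
  refine sup_le (sup_le (sup_le ?_ ?_) ?_) ?_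
  · refine Ideal.map_le_iff_le_comap.2 fun p hp => ?_
    rw [Ideal.mem_comap, Ideal.mem_comap, toConormalPairs_inclZ,
      inclLeft_mem_conormalPairsVanishing hprime, inclLeft_mem_conormalVanishing hprime]
    exact hp
  · rw [Ideal.map_map]
    refine Ideal.map_le_iff_le_comap.2 fun p hp => ?_
    rw [Ideal.mem_comap, Ideal.mem_comap, RingHom.comp_apply, toConormalPairs_starMap_inclZ,
      inclRight_mem_conormalPairsVanishing hprime, inclLeft_mem_conormalVanishing hprime']
    exact conjCoeff_mem_ideal_conjFamily f hp
  · refine Ideal.span_le.2 ?_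
    rintro _ ⟨a, b, rfl⟩
    rw [SetLike.mem_coe, Ideal.mem_comap, toConormalPairs_minor,
      inclLeft_mem_conormalPairsVanishing hprime]
    exact hc.minor_mem hprime a b
  · rw [Ideal.map_le_iff_le_comap]
    refine Ideal.span_le.2 ?_
    rintro _ ⟨a, b, rfl⟩
    rw [SetLike.mem_coe, Ideal.mem_comap, Ideal.mem_comap, toConormalPairs_starMap_minor,
      inclRight_mem_conormalPairsVanishing hprime]
    exact hc.conjFamily.minor_mem hprime' a b

/-- The unsaturated equations hold on pairs of conormal vectors, and saturating adds nothing to this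
prime ideal, since `δ` and its conjugate, which are elements of the saturating ideals, do not vanish
identically there. -/
theorem criticalIdeal_le (hprime : (ideal f).IsPrime) :
    criticalIdeal f ≤ (conormalPairsVanishing f).comap (toConormalPairs n) := by
  rintro p ⟨m, hm⟩
  have hQ := isPrime_conormalPairsVanishing f hprime
  have hprime' := isPrime_ideal_conjFamily f hprime
  obtain ⟨⟨a, b, hδ⟩, -⟩ := hasGenericRank_codim hprime
  set δ := ((jacobian f).submatrix a b).det with hδdef
  have hmem : δ ∈ singIdeal f := Ideal.mem_sup_right (Ideal.subset_span ⟨a, b, rfl⟩)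
  have h1 := hm _ (Ideal.pow_mem_pow (Ideal.mul_mem_mul (Ideal.mem_map_of_mem (inclZ n) hmem)
    (Ideal.mem_map_of_mem (starMap n) (Ideal.mem_map_of_mem (inclZ n) hmem))) m)
  have h2 := unsaturatedIdeal_le hprime h1
  rw [Ideal.mem_comap, map_mul] at h2
  rw [Ideal.mem_comap]
  refine (hQ.mem_or_mem h2).resolve_right fun h3 => ?_
  rw [map_pow, map_mul] at h3
  rcases hQ.mem_or_mem (hQ.mem_of_pow_mem _ h3) with h4 | h4
  · rw [toConormalPairs_inclZ, inclLeft_mem_conormalPairsVanishing hprime,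
      inclLeft_mem_conormalVanishing hprime] at h4
    exact hδ h4
  · rw [toConormalPairs_starMap_inclZ, inclRight_mem_conormalPairsVanishing hprime,
      inclLeft_mem_conormalVanishing hprime', mem_ideal_conjFamily, conjCoeff_conjCoeff] at h4
    exact hδ h4

end Critical

end HermitianDistance

namespace HermitianDistance

open MvPolynomial

section Critical

theorem exists_vecMul_eq_vecMul_submatrix {S ρ κ : Type*} [CommRing S] [Fintype ρ] [DecidableEq ρ]
    (J : Matrix ρ κ S) {c : ℕ} (a : Fin c → ρ) (m : Fin c → S) :
    ∃ ℓ : ρ → S, Matrix.vecMul ℓ J = Matrix.vecMul m (J.submatrix a id) := by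
  refine ⟨Matrix.vecMul m ((1 : Matrix ρ ρ S).submatrix a id), ?_⟩
  rw [Matrix.vecMul_vecMul]
  congr 1
  ext i j
  simp [Matrix.mul_apply, Matrix.one_apply]

instance finite_hVar (n : ℕ) : Finite (HVar n) :=
  Finite.of_surjective
    (Sum.elim (Sum.elim HVar.z HVar.w) (Sum.elim HVar.u HVar.v)) fun i => by
      cases i with
      | z i => exact ⟨Sum.inl (Sum.inl i), rfl⟩
      | w i => exact ⟨Sum.inl (Sum.inr i), rfl⟩
      | u i => exact ⟨Sum.inr (Sum.inl i), rfl⟩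
      | v i => exact ⟨Sum.inr (Sum.inr i), rfl⟩

variable {n s : ℕ} {f : Fin s → MvPolynomial (Fin n) ℂ}

theorem map_inclZ {S : Type*} [CommRing S] [Algebra ℂ S] (φ : HRing n →ₐ[ℂ] S)
    (p : MvPolynomial (Fin n) ℂ) :
    φ (inclZ n p) = aeval (fun i => φ (X (HVar.z i))) p := by
  have h : φ.comp (rename HVar.z) = aeval (R := ℂ) (fun i => φ (X (HVar.z i))) :=
    algHom_ext fun i => by simp
  exact DFunLike.congr_fun h p

theorem map_starMap_inclZ {S : Type*} [CommRing S] [Algebra ℂ S] (φ : HRing n →ₐ[ℂ] S)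
    (p : MvPolynomial (Fin n) ℂ) :
    φ (starMap n (inclZ n p)) = aeval (fun i => φ (X (HVar.w i))) (conjCoeff p) := by
  have h : φ.comp (rename HVar.w) = aeval (R := ℂ) (fun i => φ (X (HVar.w i))) :=
    algHom_ext fun i => by simp
  rw [starMap_inclZ]
  exact DFunLike.congr_fun h _

/-- Where the critical equations hold and the chosen Jacobian minors are invertible, the
equations of the pairs of conormal vectors hold. -/
theorem map_eq_zero_of_mem_conormalPairsVanishing (hprime : (ideal f).IsPrime) {S : Type}
    [CommRing S] [Algebra ℂ S] (φ : HRing n →ₐ[ℂ] S) (hφ : ∀ p ∈ unsaturatedIdeal f, φ p = 0)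
    {a a' : Fin (codim f) → Fin s} {b b' : Fin (codim f) → Fin n}
    (hu : IsUnit (φ (inclZ n ((jacobian f).submatrix a b).det)))
    (hu' : IsUnit (φ (starMap n (inclZ n ((jacobian f).submatrix a' b').det))))
    {p : HRing n} (hp : toConormalPairs n p ∈ conormalPairsVanishing f) : φ p = 0 := by
  have hprime' := isPrime_ideal_conjFamily f hprime
  let z : Fin n → S := fun i => φ (X (HVar.z i))
  let w : Fin n → S := fun i => φ (X (HVar.w i))
  let y : Fin n → S := fun i => φ (X (HVar.v i)) - w i
  let x : Fin n → S := fun i => φ (X (HVar.u i)) - z i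
  have hz : ∀ p, φ (inclZ n p) = aeval z p := map_inclZ φ
  have hw : ∀ p, φ (starMap n (inclZ n p)) = aeval w (conjCoeff p) := map_starMap_inclZ φ
  have hJ1 : ∀ p ∈ (ideal f).map (inclZ n), φ p = 0 := fun p hp =>
    hφ p (Ideal.mem_sup_left (Ideal.mem_sup_left (Ideal.mem_sup_left hp)))
  have hJ2 : ∀ p ∈ ((ideal f).map (inclZ n)).map (starMap n), φ p = 0 := fun p hp =>
    hφ p (Ideal.mem_sup_left (Ideal.mem_sup_left (Ideal.mem_sup_right hp)))
  have hJ3 : ∀ p ∈ conormalIdeal f, φ p = 0 := fun p hp =>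
    hφ p (Ideal.mem_sup_left (Ideal.mem_sup_right hp))
  have hJ4 : ∀ p ∈ (conormalIdeal f).map (starMap n), φ p = 0 := fun p hp =>
    hφ p (Ideal.mem_sup_right hp)
  have hfz : ∀ i, aeval z (f i) = 0 := fun i => by
    rw [← hz]
    exact hJ1 _ (Ideal.mem_map_of_mem _ (Ideal.subset_span ⟨i, rfl⟩))
  have hfw : ∀ i, aeval w (conjFamily f i) = 0 := fun i => by
    rw [conjFamily, ← hw]
    exact hJ2 _ (Ideal.mem_map_of_mem _ (Ideal.mem_map_of_mem _ (Ideal.subset_span ⟨i, rfl⟩)))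
  have hdet : ((jacobianAt f z).submatrix a b).det = aeval z ((jacobian f).submatrix a b).det :=
    (AlgHom.map_det (aeval z) _).symm
  have hdet' : ((jacobianAt (conjFamily f) w).submatrix a' b').det =
      aeval w (conjCoeff ((jacobian f).submatrix a' b').det) := by
    rw [← det_jacobian_conjFamily]
    exact (AlgHom.map_det (aeval w) _).symm
  -- An invertible minor and the vanishing bordered minors place `y = v - w` in the row space of the
  -- Jacobian at `z`, over `S` itself; the same is done for `x = u - z`.
  have hy := eq_vecMul_of_minors_eq_zero (J := jacobianAt f z) (y := y) (a := a) (b := b)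
    (by rw [hdet, ← hz]; exact hu) (fun j => by
      rw [← hJ3 _ (Ideal.subset_span ⟨Fin.cons 0 fun i => (a i).succ, Fin.cons j b, rfl⟩),
        AlgHom.map_det]
      congr 1
      ext1 k l
      simp only [AlgHom.mapMatrix_apply, Matrix.map_apply, Matrix.submatrix_apply,
        augmentedMatrix, Matrix.of_apply]
      refine Fin.cases ?_ (fun k => ?_) k
      · simp [y, w]
      · simp [hz, jacobianAt])
  have hx := eq_vecMul_of_minors_eq_zero (J := jacobianAt (conjFamily f) w) (y := x) (a := a')
    (b := b') (by rw [hdet', ← hw]; exact hu') (fun j => by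
      rw [← hJ4 _ (Ideal.mem_map_of_mem (starMap n)
        (Ideal.subset_span ⟨Fin.cons 0 fun i => (a' i).succ, Fin.cons j b', rfl⟩)),
        RingHom.map_det, AlgHom.map_det]
      congr 1
      ext1 k l
      simp only [AlgHom.mapMatrix_apply, RingHom.mapMatrix_apply, Matrix.map_apply,
        Matrix.submatrix_apply, augmentedMatrix, Matrix.of_apply]
      refine Fin.cases ?_ (fun k => ?_) k
      · simp [x, z, starMap, HVar.conj]
      · simp [hw, jacobianAt, jacobian_conjFamily])
  obtain ⟨ℓ, hℓ⟩ := exists_vecMul_eq_vecMul_submatrix (jacobianAt f z) a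
    (Matrix.vecMul (y ∘ b) ((jacobianAt f z).submatrix a b)⁻¹)
  obtain ⟨m, hm⟩ := exists_vecMul_eq_vecMul_submatrix (jacobianAt (conjFamily f) w) a'
    (Matrix.vecMul (x ∘ b') ((jacobianAt (conjFamily f) w).submatrix a' b')⁻¹)
  rw [← hℓ] at hy
  rw [← hm] at hx
  have hpt : φ = aeval (hermitianPoint z y w x) := by
    refine algHom_ext fun i => ?_
    rw [aeval_X]
    cases i <;> simp [hermitianPoint, z, y, w, x]
  rw [hpt, ← aeval_toConormalPairs]
  have hle : conormalPairsVanishing f ≤ RingHom.ker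
      (aeval (Sum.elim (Sum.elim z y) (Sum.elim w x)) :
        MvPolynomial ((Fin n ⊕ Fin n) ⊕ (Fin n ⊕ Fin n)) ℂ →ₐ[ℂ] S) := by
    refine (vanishingIdeal_prodSet_le _ _).trans (sup_le ?_ ?_)
    · refine Ideal.map_le_iff_le_comap.2 fun h hh => ?_
      rw [Ideal.mem_comap, RingHom.mem_ker, aeval_inclLeft, hy]
      exact aeval_eq_zero_of_mem_conormalVanishing hprime hfz ℓ hh
    · refine Ideal.map_le_iff_le_comap.2 fun h hh => ?_
      rw [Ideal.mem_comap, RingHom.mem_ker, aeval_inclRight, hx]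
      exact aeval_eq_zero_of_mem_conormalVanishing hprime' hfw m hh
  exact hle hp

/-- The saturation is checked one product of minors at a time: after inverting such a product `d`,
the element `p` vanishes modulo the critical equations, so some `d ^ m * p` lies in `J`. -/
theorem le_criticalIdeal (hprime : (ideal f).IsPrime) :
    (conormalPairsVanishing f).comap (toConormalPairs n) ≤ criticalIdeal f := by
  intro p hp
  let J := unsaturatedIdeal f
  -- Working in the radical of `J : p` allows the exponent to depend on the generator. A uniform
  -- exponent is recovered at the end because the saturating ideal is finitely generated.
  let R : Ideal (HRing n) := (Submodule.colon J {p}).radical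
  have hJR : J ≤ R := fun q hq => Ideal.le_radical (Submodule.mem_colon_singleton.2
    (J.mul_mem_right _ hq))
  have hgen : singIdeal f = Ideal.span (Set.range f ∪
      {d | ∃ (a : Fin (codim f) → Fin s) (b : Fin (codim f) → Fin n),
        d = ((jacobian f).submatrix a b).det}) := by
    rw [singIdeal, ideal, minorsIdeal, Ideal.span_union]
  have hK : (singIdeal f).map (inclZ n) * ((singIdeal f).map (inclZ n)).map (starMap n) ≤ R := by
    rw [hgen, Ideal.map_map, Ideal.map_span, Ideal.map_span, Ideal.span_mul_span', Ideal.span_le]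
    rintro _ ⟨_, ⟨q, hq, rfl⟩, _, ⟨q', hq', rfl⟩, rfl⟩
    rw [SetLike.mem_coe]
    dsimp only
    rcases hq with ⟨i, rfl⟩ | ⟨a, b, rfl⟩
    · refine R.mul_mem_right _ (hJR (Ideal.mem_sup_left (Ideal.mem_sup_left (Ideal.mem_sup_left ?_))))
      exact Ideal.mem_map_of_mem _ (Ideal.subset_span ⟨i, rfl⟩)
    rcases hq' with ⟨i, rfl⟩ | ⟨a', b', rfl⟩
    · refine R.mul_mem_left _ (hJR (Ideal.mem_sup_left (Ideal.mem_sup_left (Ideal.mem_sup_right ?_))))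
      exact Ideal.mem_map_of_mem _ (Ideal.mem_map_of_mem _ (Ideal.subset_span ⟨i, rfl⟩))
    obtain ⟨d, hd⟩ : ∃ d, d = inclZ n ((jacobian f).submatrix a b).det *
      ((starMap n).comp (inclZ n)) ((jacobian f).submatrix a' b').det := ⟨_, rfl⟩
    rw [← hd]
    let A := HRing n ⧸ J
    let S := Localization.Away (Ideal.Quotient.mk J d)
    let φ : HRing n →ₐ[ℂ] S := (IsScalarTower.toAlgHom ℂ A S).comp (Ideal.Quotient.mkₐ ℂ J)
    have hφd : IsUnit (φ d) :=
      IsLocalization.Away.algebraMap_isUnit (S := S) (Ideal.Quotient.mk J d)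
    have hφ2 : φ d = φ (inclZ n ((jacobian f).submatrix a b).det) *
        φ (starMap n (inclZ n ((jacobian f).submatrix a' b').det)) :=
      (congrArg φ hd).trans (map_mul φ _ _)
    rw [hφ2, IsUnit.mul_iff] at hφd
    have hφJ : ∀ q ∈ J, φ q = 0 := fun q hq => by
      change algebraMap A S (Ideal.Quotient.mk J q) = 0
      rw [Ideal.Quotient.eq_zero_iff_mem.2 hq, map_zero]
    have h0 := map_eq_zero_of_mem_conormalPairsVanishing hprime φ hφJ hφd.1 hφd.2 hp
    obtain ⟨⟨_, m, rfl⟩, hm⟩ := (IsLocalization.map_eq_zero_iff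
      (Submonoid.powers (Ideal.Quotient.mk J d)) S (Ideal.Quotient.mk J p)).1 h0
    refine ⟨m, Submodule.mem_colon_singleton.2 ?_⟩
    rw [smul_eq_mul, ← Ideal.Quotient.eq_zero_iff_mem, map_mul, map_pow]
    exact hm
  obtain ⟨m, hm⟩ := Ideal.exists_pow_le_of_le_radical_of_fg hK (IsNoetherian.noetherian _)
  refine ⟨m, fun q hq => ?_⟩
  have := Submodule.mem_colon_singleton.1 (hm hq)
  rwa [smul_eq_mul, mul_comm] at this

/-- The Hermitian critical ideal is the vanishing ideal of the product of the conormal variety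
with its conjugate, in suitable coordinates. -/
theorem criticalIdeal_eq (hprime : (ideal f).IsPrime) :
    criticalIdeal f = (conormalPairsVanishing f).comap (toConormalPairs n) :=
  le_antisymm (criticalIdeal_le hprime) (le_criticalIdeal hprime)

theorem mem_criticalIdeal (hprime : (ideal f).IsPrime) {p : HRing n} :
    p ∈ criticalIdeal f ↔ ∀ z y, Sum.elim z y ∈ conormalSet f →
      ∀ w x, Sum.elim w x ∈ conormalSet (conjFamily f) →
        aeval (hermitianPoint z y w x) p = 0 := by
  rw [criticalIdeal_eq hprime, Ideal.mem_comap, conormalPairsVanishing, mem_vanishingIdeal_prodSet]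
  simp only [← aeval_toConormalPairs]
  refine ⟨fun h z y hy w x hx => h _ hy _ hx, fun h y hy x hx => ?_⟩
  rw [← Sum.elim_comp_inl_inr y, ← Sum.elim_comp_inl_inr x] at *
  exact h _ _ hy _ _ hx

end Critical

end HermitianDistance

namespace HermitianDistance

open MvPolynomial

/-! ### Ideals stable under derivations, and full-rank specialisations. -/

section Derivations

/-- A proper ideal of a polynomial ring that is closed under the partial derivatives is zero. -/
theorem eq_zero_of_pderiv_mem {σ : Type*} {I : Ideal (MvPolynomial σ ℂ)} (hI : I ≠ ⊤)
    (hD : ∀ p ∈ I, ∀ i, pderiv i p ∈ I) {p : MvPolynomial σ ℂ} (hp : p ∈ I) : p = 0 := by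
  suffices h : ∀ N, ∀ p ∈ I, p.totalDegree ≤ N → p = 0 from h _ p hp le_rfl
  intro N
  induction N with
  | zero =>
    intro p hp hN
    obtain ⟨a, ha⟩ : ∃ a, p = C a := ⟨_, totalDegree_eq_zero_iff_eq_C.1 (Nat.le_zero.1 hN)⟩
    subst ha
    by_contra h
    have ha : a ≠ 0 := fun h0 => h (by rw [h0, C_0])
    exact hI (Ideal.eq_top_of_isUnit_mem _ hp ((isUnit_iff_ne_zero.2 ha).map C))
  | succ N ih =>
    intro p hp hN
    -- Partial derivatives lie in the ideal and have smaller degree. Once they all vanish, `p` is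
    -- constant, because exponents are invertible in characteristic zero.
    have h0 : ∀ i, pderiv i p = 0 := fun i => by
      refine ih _ (hD p hp i) ?_
      refine Finset.sup_le fun m hm => ?_
      rw [mem_support_iff, coeff_pderiv] at hm
      have h1 := (le_totalDegree (mem_support_iff.2 (left_ne_zero_of_mul hm))).trans hN
      rw [Finsupp.sum_add_index' (fun _ => rfl) (fun _ _ _ => rfl),
        Finsupp.sum_single_index rfl] at h1
      omega
    refine ih p hp ?_
    refine Finset.sup_le fun m hm => ?_
    by_cases hm0 : m = 0
    · simp [hm0]
    · obtain ⟨i, hi⟩ := Finsupp.ne_iff.1 hm0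
      rw [mem_support_iff] at hm
      have h1 := congrArg (coeff (m - Finsupp.single i 1)) (h0 i)
      have h2 : m - Finsupp.single i 1 + Finsupp.single i 1 = m :=
        tsub_add_cancel_of_le (Finsupp.single_le_iff.2 (Nat.one_le_iff_ne_zero.2 hi))
      rw [coeff_pderiv, h2, coeff_zero] at h1
      refine absurd h1 (mul_ne_zero hm ?_)
      exact Nat.cast_add_one_ne_zero (R := ℂ) _

/-- A derivation that maps generators of an ideal into the ideal preserves the ideal. -/
theorem derivation_mem_span {R : Type*} [CommRing R] [Algebra ℂ R] (D : Derivation ℂ R R)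
    {S : Set R} (hS : ∀ p ∈ S, D p ∈ Ideal.span S) {p : R} (hp : p ∈ Ideal.span S) :
    D p ∈ Ideal.span S := by
  induction hp using Submodule.span_induction with
  | mem x hx => exact hS x hx
  | zero => simp
  | add x y _ _ hx hy => rw [map_add]; exact Ideal.add_mem _ hx hy
  | smul a x hx h =>
    rw [smul_eq_mul, Derivation.leibniz, smul_eq_mul, smul_eq_mul]
    exact Ideal.add_mem _ (Ideal.mul_mem_left _ _ h) (Ideal.mul_mem_right _ _ hx)

/-- If the value of `M` at a point of the variety of the prime `Q` has trivial left kernel, then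
so does the class of `M` modulo `Q`. -/
theorem mem_of_vecMul_mem {ρ α ι : Type*} [Fintype α] [Fintype ι]
    {Q : Ideal (MvPolynomial ρ ℂ)} (hQ : Q.IsPrime) {x : ρ → ℂ} (hx : ∀ p ∈ Q, aeval x p = 0)
    (M : Matrix α ι (MvPolynomial ρ ℂ))
    (hM : ∀ v : α → ℂ, Matrix.vecMul v (M.map (aeval x)) = 0 → v = 0)
    {G : α → MvPolynomial ρ ℂ} (hG : ∀ j, Matrix.vecMul G M j ∈ Q) (k : α) : G k ∈ Q := by
  classical
  let N := M.map (aeval x)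
  -- At `x` this becomes `N * Nᴴ`, which is nonsingular when `N` has trivial left kernel. Hence `det
  -- B` is nonzero modulo `Q`, and `G * B = 0` modulo `Q` forces `G = 0` there.
  let B : Matrix α α (MvPolynomial ρ ℂ) := M * N.conjTranspose.map C
  have hdet : aeval x B.det ≠ 0 := by
    have h1 : aeval x B.det = (N * N.conjTranspose).det := by
      rw [AlgHom.map_det]
      congr 1
      ext i j
      change aeval x (∑ l, M i l * C (star (N j l))) = ∑ l, N i l * star (N j l)
      rw [map_sum]
      simp [N]
    rw [h1]
    intro h2
    obtain ⟨v, hv, hv0⟩ := Matrix.exists_vecMul_eq_zero_iff.2 h2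
    refine hv (hM v ?_)
    open scoped ComplexOrder in
    exact (Matrix.vecMul_self_mul_conjTranspose_eq_zero N v).1 hv0
  let π := Ideal.Quotient.mk Q
  have hGB : Matrix.vecMul (π ∘ G) (B.map π) = 0 := by
    have h1 : Matrix.vecMul (π ∘ G) (M.map π) = 0 := by
      funext j
      rw [← RingHom.map_vecMul]
      exact Ideal.Quotient.eq_zero_iff_mem.2 (hG j)
    have h2 : B.map π = M.map π * (N.conjTranspose.map C).map π := Matrix.map_mul
    rw [h2, ← Matrix.vecMul_vecMul, h1, Matrix.zero_vecMul]
  have h3 : (B.map π).det ≠ 0 := by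
    have : (B.map π).det = π B.det := (RingHom.map_det π B).symm
    rw [this]
    exact fun h => hdet (hx _ (Ideal.Quotient.eq_zero_iff_mem.1 h))
  have h4 := Matrix.eq_zero_of_vecMul_eq_zero h3 hGB
  exact Ideal.Quotient.eq_zero_iff_mem.1 (congrFun h4 k)

end Derivations

/-! ### Polynomial tangent fields on the variety. -/

section Tangent

variable {n s c : ℕ} {f : Fin s → MvPolynomial (Fin n) ℂ}

/-- A matrix of polynomials whose columns are tangent to the variety at all of its points, once
`c` is the generic rank of the Jacobian. -/
noncomputable def tangentMatrix (f : Fin s → MvPolynomial (Fin n) ℂ) (a : Fin c → Fin s)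
    (b : Fin c → Fin n) : Matrix (Fin n) (Fin n) (MvPolynomial (Fin n) ℂ) :=
  ((jacobian f).submatrix a b).det • (1 : Matrix (Fin n) (Fin n) (MvPolynomial (Fin n) ℂ)) -
    (1 : Matrix (Fin n) (Fin n) (MvPolynomial (Fin n) ℂ)).submatrix id b *
      (((jacobian f).submatrix a b).adjugate * (jacobian f).submatrix a id)

/-- The product is `δ J - J_b adj(J_ab) J_a`, where `δ` is the determinant of the minor `J_ab`. Its
rows vanish on `X` by Cramer's rule, since all `(c+1)`-minors do. -/
theorem HasGenericRank.jacobian_mul_tangentMatrix_mem (hprime : (ideal f).IsPrime)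
    (hc : HasGenericRank f c) {a : Fin c → Fin s} {b : Fin c → Fin n}
    (hab : ((jacobian f).submatrix a b).det ∉ ideal f) (i : Fin s) (j : Fin n) :
    (jacobian f * tangentMatrix f a b) i j ∈ ideal f := by
  let π := Ideal.Quotient.mk (ideal f)
  have hadj : ((jacobian f).submatrix a b).adjugate.map π =
      (((jacobian f).map π).submatrix a b).adjugate :=
    RingHom.map_adjugate π ((jacobian f).submatrix a b)
  have hdet : (((jacobian f).map π).submatrix a b).det = π ((jacobian f).submatrix a b).det :=
    (RingHom.map_det π _).symm
  have h := det_mul_eq_of_minors (J := (jacobian f).map π) (y := (jacobian f).map π i)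
    (a := a) (b := b) (by rw [hdet]; exact fun h => hab (Ideal.Quotient.eq_zero_iff_mem.1 h))
    (fun j => by
      rw [← Ideal.Quotient.eq_zero_iff_mem.2 (hc.2 (Fin.cons i a) (Fin.cons j b)), RingHom.map_det]
      congr 1
      ext x y
      refine Fin.cases ?_ (fun x => ?_) x <;> simp [π]) j
  rw [← Ideal.Quotient.eq_zero_iff_mem]
  rw [hdet, ← hadj] at h
  have h2 : jacobian f * tangentMatrix f a b = ((jacobian f).submatrix a b).det • jacobian f -
      (jacobian f).submatrix id b *
        (((jacobian f).submatrix a b).adjugate * (jacobian f).submatrix a id) := by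
    rw [tangentMatrix, Matrix.mul_sub, Matrix.mul_smul, Matrix.mul_one, ← Matrix.mul_assoc]
    congr 2
    ext i j
    simp [Matrix.mul_apply, Matrix.one_apply]
  rw [h2, Matrix.sub_apply, map_sub, Matrix.smul_apply, smul_eq_mul, map_mul, sub_eq_zero]
  refine Eq.trans h ?_
  rw [Matrix.vecMul_vecMul]
  simp [Matrix.mul_apply, Matrix.vecMul, dotProduct, π]

theorem tangentMatrix_mulVec {a : Fin c → Fin s} {b : Fin c → Fin n} {z x : Fin n → ℂ}
    (hx : (jacobianAt f z).mulVec x = 0) :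
    ((tangentMatrix f a b).map (aeval z)).mulVec x =
      aeval z ((jacobian f).submatrix a b).det • x := by
  have h : (tangentMatrix f a b).map (aeval z) =
      aeval z ((jacobian f).submatrix a b).det • (1 : Matrix (Fin n) (Fin n) ℂ) -
      (1 : Matrix (Fin n) (Fin n) ℂ).submatrix id b *
        (((jacobian f).submatrix a b).adjugate.map (aeval z) *
          (jacobianAt f z).submatrix a id) := by
    ext i j
    simp [tangentMatrix, Matrix.mul_apply, Matrix.one_apply, jacobianAt, apply_ite]
  have h2 : ((jacobianAt f z).submatrix a id).mulVec x = 0 := by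
    funext i
    exact congrFun hx (a i)
  rw [h, Matrix.sub_mulVec, ← Matrix.mulVec_mulVec, ← Matrix.mulVec_mulVec, h2,
    Matrix.mulVec_zero, Matrix.mulVec_zero, sub_zero, Matrix.smul_mulVec, Matrix.one_mulVec]

/-- The vector `star v` is tangent and `v` annihilates all tangent vectors, so `∑ vᵢ v̄ᵢ = 0`.
Positivity of the Hermitian form is what makes the data map dominant. -/
theorem eq_zero_of_conj_orthogonal {a : Fin c → Fin s} {b : Fin c → Fin n} {z v : Fin n → ℂ}
    (hz : aeval z ((jacobian f).submatrix a b).det ≠ 0)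
    (hv : (jacobianAt f z).mulVec (star v) = 0)
    (hv' : Matrix.vecMul v ((tangentMatrix f a b).map (aeval z)) = 0) : v = 0 := by
  have h1 : v ⬝ᵥ ((tangentMatrix f a b).map (aeval z)).mulVec (star v) = 0 := by
    rw [Matrix.dotProduct_mulVec, hv', zero_dotProduct]
  rw [tangentMatrix_mulVec hv, dotProduct_smul, smul_eq_zero] at h1
  open scoped ComplexOrder in
  exact dotProduct_self_star_eq_zero.1 (h1.resolve_left hz)

end Tangent

end HermitianDistance

namespace HermitianDistance

open MvPolynomial

/-! ### Dominance of the map from pairs of conormal vectors to the data `(u, v)`. -/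

section Dominance

variable {n s : ℕ} (f : Fin s → MvPolynomial (Fin n) ℂ)

/-- The ideal of the product of the parameter spaces of the conormal variety and its conjugate. -/
noncomputable def paramPairsVanishing :
    Ideal (MvPolynomial ((Fin n ⊕ Fin s) ⊕ (Fin n ⊕ Fin s)) ℂ) :=
  vanishingIdeal ℂ (prodSet (prodSet (variety f) (Set.univ : Set (Fin s → ℂ)))
    (prodSet (variety (conjFamily f)) (Set.univ : Set (Fin s → ℂ))))

theorem isPrime_paramPairsVanishing (hprime : (ideal f).IsPrime) :
    (paramPairsVanishing f).IsPrime :=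
  isPrime_vanishingIdeal_prodSet (isPrime_vanishingIdeal_param hprime _)
    (isPrime_vanishingIdeal_param (isPrime_ideal_conjFamily f hprime) _)

theorem mem_paramPairsVanishing {p : MvPolynomial ((Fin n ⊕ Fin s) ⊕ (Fin n ⊕ Fin s)) ℂ} :
    p ∈ paramPairsVanishing f ↔ ∀ z ∈ variety f, ∀ ℓ, ∀ w ∈ variety (conjFamily f), ∀ m,
      aeval (Sum.elim (Sum.elim z ℓ) (Sum.elim w m)) p = 0 := by
  rw [paramPairsVanishing, mem_vanishingIdeal_prodSet]
  refine ⟨fun h z hz ℓ w hw m => h _ (sumElim_mem_prodSet hz (Set.mem_univ ℓ)) _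
    (sumElim_mem_prodSet hw (Set.mem_univ m)), fun h x hx y hy => ?_⟩
  rw [← Sum.elim_comp_inl_inr x, ← Sum.elim_comp_inl_inr y]
  exact h _ hx.1 _ _ hy.1 _

/-- Explicit generators, so that stability under the tangential derivations can be checked on them
alone. -/
theorem paramPairsVanishing_eq_span (hprime : (ideal f).IsPrime) :
    paramPairsVanishing f = Ideal.span
      (Set.range (fun i => inclLeft (inclLeft (f i))) ∪
        Set.range (fun i => inclRight (inclLeft (conjFamily f i)))) := by
  refine le_antisymm ?_ (Ideal.span_le.2 ?_)
  · have hprime' := isPrime_ideal_conjFamily f hprime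
    refine (vanishingIdeal_prodSet_le _ _).trans (sup_le ?_ ?_)
    · refine (Ideal.map_mono (vanishingIdeal_prodSet_le _ _)).trans ?_
      rw [vanishingIdeal_univ, Ideal.map_bot, sup_bot_eq, vanishingIdeal_variety hprime, ideal,
        Ideal.map_span, Ideal.map_span, ← Set.range_comp, ← Set.range_comp]
      exact Ideal.span_mono Set.subset_union_left
    · refine (Ideal.map_mono (vanishingIdeal_prodSet_le _ _)).trans ?_
      rw [vanishingIdeal_univ, Ideal.map_bot, sup_bot_eq, vanishingIdeal_variety hprime', ideal,
        Ideal.map_span, Ideal.map_span, ← Set.range_comp, ← Set.range_comp]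
      exact Ideal.span_mono Set.subset_union_right
  · rintro _ (⟨i, rfl⟩ | ⟨i, rfl⟩)
    · rw [SetLike.mem_coe, mem_paramPairsVanishing]
      intro z hz ℓ w hw m
      rw [aeval_inclLeft, aeval_inclLeft]
      exact mem_variety_iff.1 hz i
    · rw [SetLike.mem_coe, mem_paramPairsVanishing]
      intro z hz ℓ w hw m
      rw [aeval_inclRight, aeval_inclLeft]
      exact mem_variety_iff.1 hw i

/-- The directions of differentiation on the parameter space of the pairs. -/
noncomputable def tangentField {c : ℕ} (a : Fin c → Fin s) (b : Fin c → Fin n) :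
    Matrix ((Fin n ⊕ Fin s) ⊕ (Fin n ⊕ Fin s)) ((Fin n ⊕ Fin s) ⊕ (Fin n ⊕ Fin s))
      (MvPolynomial ((Fin n ⊕ Fin s) ⊕ (Fin n ⊕ Fin s)) ℂ) :=
  Matrix.fromBlocks
    (Matrix.fromBlocks ((tangentMatrix f a b).map fun p => inclLeft (inclLeft p)) 0 0 1) 0 0
    (Matrix.fromBlocks ((tangentMatrix (conjFamily f) a b).map fun p => inclRight (inclLeft p))
      0 0 1)

theorem inclLeft_inclLeft_eq_aeval {σ τ κ : Type*} (p : MvPolynomial σ ℂ) :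
    (inclLeft (inclLeft p) : MvPolynomial ((σ ⊕ τ) ⊕ κ) ℂ) =
      aeval (fun i => X (Sum.inl (Sum.inl i))) p := by
  have : (inclLeft.comp inclLeft : MvPolynomial σ ℂ →ₐ[ℂ] MvPolynomial ((σ ⊕ τ) ⊕ κ) ℂ) =
      aeval (fun i => X (Sum.inl (Sum.inl i))) := algHom_ext fun i => by simp [inclLeft]
  exact DFunLike.congr_fun this p

theorem inclRight_inclLeft_eq_aeval {σ τ κ : Type*} (p : MvPolynomial σ ℂ) :
    (inclRight (inclLeft p) : MvPolynomial (κ ⊕ (σ ⊕ τ)) ℂ) =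
      aeval (fun i => X (Sum.inr (Sum.inl i))) p := by
  have : (inclRight.comp inclLeft : MvPolynomial σ ℂ →ₐ[ℂ] MvPolynomial (κ ⊕ (σ ⊕ τ)) ℂ) =
      aeval (fun i => X (Sum.inr (Sum.inl i))) := algHom_ext fun i => by simp [inclLeft, inclRight]
  exact DFunLike.congr_fun this p

theorem map_inclLeft_mem_paramPairsVanishing (hprime : (ideal f).IsPrime)
    {p : MvPolynomial (Fin n) ℂ} (hp : p ∈ ideal f) :
    inclLeft (inclLeft p) ∈ paramPairsVanishing f := by
  rw [mem_paramPairsVanishing]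
  intro z hz ℓ w hw m
  rw [aeval_inclLeft, aeval_inclLeft]
  exact (mem_ideal_iff hprime).1 hp z hz

theorem map_inclRight_mem_paramPairsVanishing (hprime : (ideal f).IsPrime)
    {p : MvPolynomial (Fin n) ℂ} (hp : p ∈ ideal (conjFamily f)) :
    inclRight (inclLeft p) ∈ paramPairsVanishing f := by
  rw [mem_paramPairsVanishing]
  intro z hz ℓ w hw m
  rw [aeval_inclRight, aeval_inclLeft]
  exact (mem_ideal_iff (isPrime_ideal_conjFamily f hprime)).1 hp w hw

variable {f} in
theorem mkDerivation_tangentField_mem (hprime : (ideal f).IsPrime) {c : ℕ}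
    (hc : HasGenericRank f c) {a : Fin c → Fin s} {b : Fin c → Fin n}
    (hab : ((jacobian f).submatrix a b).det ∉ ideal f) (j)
    {p : MvPolynomial ((Fin n ⊕ Fin s) ⊕ (Fin n ⊕ Fin s)) ℂ} (hp : p ∈ paramPairsVanishing f) :
    mkDerivation ℂ (fun k => tangentField f a b k j) p ∈ paramPairsVanishing f := by
  have hab' : ((jacobian (conjFamily f)).submatrix a b).det ∉ ideal (conjFamily f) := by
    rwa [det_jacobian_conjFamily, mem_ideal_conjFamily, conjCoeff_conjCoeff]
  have hprime' := isPrime_ideal_conjFamily f hprime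
  have hs := paramPairsVanishing_eq_span f hprime
  rw [hs] at hp ⊢
  refine derivation_mem_span _ ?_ hp
  rw [← hs]
  rintro _ (⟨i, rfl⟩ | ⟨i, rfl⟩)
  · beta_reduce
    rw [inclLeft_inclLeft_eq_aeval, derivation_aeval]
    simp only [mkDerivation_X, ← inclLeft_inclLeft_eq_aeval]
    rcases j with (j | j) | j
    · have := map_inclLeft_mem_paramPairsVanishing f hprime
        (hc.jacobian_mul_tangentMatrix_mem hprime hab i j)
      simpa [Matrix.mul_apply, tangentField, jacobian] using this
    · simp [tangentField]
    · simp [tangentField]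
  · beta_reduce
    rw [inclRight_inclLeft_eq_aeval, derivation_aeval]
    simp only [mkDerivation_X, ← inclRight_inclLeft_eq_aeval]
    rcases j with j | j | j
    · simp [tangentField]
    · have := map_inclRight_mem_paramPairsVanishing f hprime
        (hc.conjFamily.jacobian_mul_tangentMatrix_mem hprime' hab' i j)
      simpa [Matrix.mul_apply, tangentField, jacobian] using this
    · simp [tangentField]

/-- The data point `(u, v)` as a function of the parameters of the pair of conormal vectors. -/
noncomputable def dataParam :
    Fin n ⊕ Fin n → MvPolynomial ((Fin n ⊕ Fin s) ⊕ (Fin n ⊕ Fin s)) ℂ :=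
  Sum.elim
    (fun k => X (Sum.inl (Sum.inl k)) +
      ∑ i, X (Sum.inr (Sum.inr i)) * inclRight (inclLeft (jacobian (conjFamily f) i k)))
    (fun k => X (Sum.inr (Sum.inl k)) +
      ∑ i, X (Sum.inl (Sum.inr i)) * inclLeft (inclLeft (jacobian f i k)))

theorem aeval_dataParam (z w : Fin n → ℂ) (ℓ m : Fin s → ℂ) (h : PRing n) :
    aeval (Sum.elim (Sum.elim z ℓ) (Sum.elim w m)) (aeval (dataParam f) h) =
      aeval (hermitianPoint z (Matrix.vecMul ℓ (jacobianAt f z)) w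
        (Matrix.vecMul m (jacobianAt (conjFamily f) w))) (inclUV n h) := by
  change _ = aeval _ (rename _ h)
  rw [aeval_rename]
  have : (aeval (Sum.elim (Sum.elim z ℓ) (Sum.elim w m))).comp (aeval (dataParam f)) =
      aeval (R := ℂ) (hermitianPoint z (Matrix.vecMul ℓ (jacobianAt f z)) w
        (Matrix.vecMul m (jacobianAt (conjFamily f) w)) ∘ Sum.elim HVar.u HVar.v) := by
    refine algHom_ext fun k => ?_
    rcases k with k | k
    · simp [dataParam, hermitianPoint, aeval_inclLeft, aeval_inclRight, Matrix.vecMul, dotProduct,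
        jacobianAt, -aeval_eq_eval]
    · simp [dataParam, hermitianPoint, aeval_inclLeft, Matrix.vecMul, dotProduct,
        jacobianAt, -aeval_eq_eval]
  exact DFunLike.congr_fun this h

theorem inclUV_mem_criticalIdeal (hprime : (ideal f).IsPrime) {h : PRing n} :
    inclUV n h ∈ criticalIdeal f ↔ aeval (dataParam f) h ∈ paramPairsVanishing f := by
  rw [mem_criticalIdeal hprime, mem_paramPairsVanishing]
  simp only [aeval_dataParam]
  refine ⟨fun H z hz ℓ w hw m => H z _ ⟨z, hz, ℓ, rfl⟩ w _ ⟨w, hw, m, rfl⟩, ?_⟩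
  rintro H z y ⟨z', hz, ℓ, h1⟩ w x ⟨w', hw, m, h2⟩
  obtain ⟨rfl, rfl⟩ := Sum.elim_eq_iff.1 h1
  obtain ⟨rfl, rfl⟩ := Sum.elim_eq_iff.1 h2
  exact H _ hz ℓ _ hw m

end Dominance

end HermitianDistance

namespace HermitianDistance

open MvPolynomial

section Dominance

variable {n s : ℕ} {f : Fin s → MvPolynomial (Fin n) ℂ}

/-- The differential of the data map is computed at `ℓ = m = 0`, where the terms containing
derivatives of the Jacobian drop out. -/
theorem aeval_mkDerivation_dataParam_inl {c : ℕ} (a : Fin c → Fin s) (b : Fin c → Fin n)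
    (z w : Fin n → ℂ) (k : Fin n) (j) :
    aeval (Sum.elim (Sum.elim z 0) (Sum.elim w 0))
      (mkDerivation ℂ (fun k => tangentField f a b k j) (dataParam f (Sum.inl k))) =
      Sum.elim (Sum.elim (fun j => aeval z (tangentMatrix f a b k j)) 0)
        (Sum.elim 0 (fun i => jacobianAt (conjFamily f) w i k)) j := by
  rcases j with (j | j) | j | j <;>
  simp [dataParam, tangentField, mkDerivation_X, aeval_inclLeft, Matrix.one_apply,
    jacobianAt, apply_ite, aeval_inclRight, -aeval_eq_eval]

theorem aeval_mkDerivation_dataParam_inr {c : ℕ} (a : Fin c → Fin s) (b : Fin c → Fin n)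
    (z w : Fin n → ℂ) (k : Fin n) (j) :
    aeval (Sum.elim (Sum.elim z 0) (Sum.elim w 0))
      (mkDerivation ℂ (fun k => tangentField f a b k j) (dataParam f (Sum.inr k))) =
      Sum.elim (Sum.elim (0 : Fin n → ℂ) (fun i => jacobianAt f z i k))
        (Sum.elim (fun j => aeval w (tangentMatrix (conjFamily f) a b k j)) 0) j := by
  rcases j with (j | j) | j | j <;>
  simp [dataParam, tangentField, mkDerivation_X, aeval_inclLeft, Matrix.one_apply,
    jacobianAt, apply_ite, aeval_inclRight, -aeval_eq_eval]

theorem star_mulVec_jacobianAt (f : Fin s → MvPolynomial (Fin n) ℂ) {z v : Fin n → ℂ}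
    (h : (jacobianAt (conjFamily f) (star z)).mulVec v = 0) :
    (jacobianAt f z).mulVec (star v) = 0 := by
  funext i
  have h1 := congrArg (starRingEnd ℂ) (congrFun h i)
  simp only [Matrix.mulVec, dotProduct, map_sum, map_mul, Pi.zero_apply, map_zero] at h1 ⊢
  rw [← h1]
  refine Finset.sum_congr rfl fun j _ => ?_
  have h2 : jacobianAt (conjFamily f) (star z) i j = starRingEnd ℂ (jacobianAt f z i j) :=
    jacobianAt_conjFamily f z i j
  rw [h2, Complex.conj_conj]
  rfl

/-- The data point of a pair of conormal vectors is generic: no nonzero polynomial in `u` and `v`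
lies in the critical ideal. -/
theorem eq_zero_of_inclUV_mem_criticalIdeal (hprime : (ideal f).IsPrime) {h : PRing n}
    (hh : inclUV n h ∈ criticalIdeal f) : h = 0 := by
  have hQ := isPrime_paramPairsVanishing f hprime
  have hc := hasGenericRank_codim hprime
  obtain ⟨a, b, hab⟩ := hc.1
  obtain ⟨z, hz, hδ⟩ : ∃ z ∈ variety f, aeval z ((jacobian f).submatrix a b).det ≠ 0 := by
    by_contra! H
    exact hab ((mem_ideal_iff hprime).2 H)
  have hw : star z ∈ variety (conjFamily f) := by
    rw [mem_variety_conjFamily]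
    simpa using hz
  have hδ' : aeval (star z) ((jacobian (conjFamily f)).submatrix a b).det ≠ 0 := by
    rw [det_jacobian_conjFamily]
    exact fun H => hδ ((map_eq_zero (starRingEnd ℂ)).1 ((aeval_conjCoeff z _).symm.trans H))
  rw [inclUV_mem_criticalIdeal f hprime] at hh
  -- The relations between the data coordinates form a proper ideal. By the chain rule and the full
  -- rank of the differential this ideal is closed under partial derivatives, hence zero. The rank
  -- is tested at `w = star z`, `ℓ = m = 0`, with `z` a point where the minor is nonzero.
  refine eq_zero_of_pderiv_mem (I := (paramPairsVanishing f).comap (aeval (dataParam f)))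
    (Ideal.comap_ne_top _ hQ.ne_top) (fun p hp k => ?_) hh
  refine mem_of_vecMul_mem hQ (x := Sum.elim (Sum.elim z 0) (Sum.elim (star z) 0))
    (fun q hq => (mem_paramPairsVanishing f).1 hq z hz 0 _ hw 0)
    (Matrix.of fun k j => mkDerivation ℂ (fun k => tangentField f a b k j) (dataParam f k))
    (fun v hv => ?_) (G := fun k => aeval (dataParam f) (pderiv k p)) (fun j => ?_) k
  -- The `m`-columns say that the conjugate of this covector is tangent at `z`, and the `z`-columns
  -- that the covector annihilates tangent vectors.
  · have hv1 : v ∘ Sum.inl = 0 := by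
      refine eq_zero_of_conj_orthogonal (a := a) (b := b) hδ (star_mulVec_jacobianAt f ?_) ?_
      · funext i
        have := congrFun hv (Sum.inr (Sum.inr i))
        simpa [Matrix.vecMul, Matrix.mulVec, dotProduct, aeval_mkDerivation_dataParam_inl,
          aeval_mkDerivation_dataParam_inr, -aeval_eq_eval, mul_comm] using this
      · funext j
        have := congrFun hv (Sum.inl (Sum.inl j))
        simpa [Matrix.vecMul, dotProduct, aeval_mkDerivation_dataParam_inl,
          aeval_mkDerivation_dataParam_inr, -aeval_eq_eval] using this
    have hv2 : v ∘ Sum.inr = 0 := by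
      refine eq_zero_of_conj_orthogonal (f := conjFamily f) (a := a) (b := b) hδ'
        (star_mulVec_jacobianAt (conjFamily f) ?_) ?_
      · rw [conjFamily_conjFamily, star_star]
        funext i
        have := congrFun hv (Sum.inl (Sum.inr i))
        simpa [Matrix.vecMul, Matrix.mulVec, dotProduct, aeval_mkDerivation_dataParam_inl,
          aeval_mkDerivation_dataParam_inr, -aeval_eq_eval, mul_comm] using this
      · funext j
        have := congrFun hv (Sum.inr (Sum.inl j))
        simpa [Matrix.vecMul, dotProduct, aeval_mkDerivation_dataParam_inl,
          aeval_mkDerivation_dataParam_inr, -aeval_eq_eval] using this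
    rw [← Sum.elim_comp_inl_inr v, hv1, hv2]
    exact Sum.elim_zero_zero
  · have := mkDerivation_tangentField_mem hprime hc hab j hp
    rw [derivation_aeval] at this
    exact this

end Dominance

end HermitianDistance

namespace HermitianDistance

/-! ### Principal prime ideals over a factorial ring. -/

section PrincipalPrime

open Polynomial

/-- A prime ideal of `R[T]` over a factorial ring `R` that meets `R` in zero is principal. -/
theorem exists_span_singleton_of_isPrime {R : Type*} [CommRing R] [IsDomain R]
    [UniqueFactorizationMonoid R] {K : Ideal R[X]} (hK : K.IsPrime)
    (h0 : ∀ r, C r ∈ K → r = 0) : ∃ P, K = Ideal.span {P} := by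
  by_cases hbot : K = ⊥
  · exact ⟨0, by rw [hbot, Ideal.span_singleton_zero]⟩
  classical
  obtain ⟨_⟩ : Nonempty (NormalizedGCDMonoid R) := inferInstance
  -- A prime element of `K` is not constant, because `K` contains no nonzero constants. So it is
  -- primitive and stays irreducible over the fraction field, where Gauss's lemma tests
  -- divisibility.
  obtain ⟨P, hPK, hP⟩ := hK.exists_mem_prime_of_ne_bot hbot
  have hdeg : P.natDegree ≠ 0 := fun h => by
    rw [natDegree_eq_zero] at h
    obtain ⟨r, rfl⟩ := h
    exact hP.ne_zero (by rw [h0 r hPK, C_0])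
  have hprim : P.IsPrimitive := hP.irreducible.isPrimitive hdeg
  let F := FractionRing R
  have hirr : Irreducible (P.map (algebraMap R F)) :=
    hprim.irreducible_iff_irreducible_map_fraction_map.1 hP.irreducible
  refine ⟨P, le_antisymm (fun B hB => ?_) ((Ideal.span_singleton_le_iff_mem K).2 hPK)⟩
  rw [Ideal.mem_span_singleton, hprim.dvd_iff_fraction_map_dvd_fraction_map F]
  by_contra hnd
  -- Were some `B` in `K` not divisible by `P`, clearing denominators in a Bézout identity would put
  -- a nonzero constant into `K`.
  obtain ⟨a, b, hab⟩ := (hirr.coprime_iff_not_dvd).2 hnd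
  obtain ⟨d, hd0, hd⟩ := IsLocalization.integerNormalization_spec (nonZeroDivisors R) a
  obtain ⟨e, he0, he⟩ := IsLocalization.integerNormalization_spec (nonZeroDivisors R) b
  set a' := IsLocalization.integerNormalization (nonZeroDivisors R) a
  set b' := IsLocalization.integerNormalization (nonZeroDivisors R) b
  have h1 : C (d * e) = C e * a' * P + C d * b' * B := by
    apply map_injective (algebraMap R F) (IsFractionRing.injective R F)
    have hs : ∀ (r : R) (p : F[X]), r • p = C (algebraMap R F r) * p := fun r p => by
      rw [← algebraMap_smul F r p, smul_eq_C_mul]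
    rw [Polynomial.map_add, Polynomial.map_mul, Polynomial.map_mul, Polynomial.map_mul,
      Polynomial.map_mul, hd, he, map_C, map_C, map_C, hs, hs, map_mul, C_mul]
    linear_combination -(C (algebraMap R F d) * C (algebraMap R F e)) * hab
  have h2 : C (d * e) ∈ K := by
    rw [h1]
    exact K.add_mem (K.mul_mem_left _ hPK) (K.mul_mem_left _ hB)
  exact mul_ne_zero (nonZeroDivisors.ne_zero hd0) (nonZeroDivisors.ne_zero he0) (h0 _ h2)

end PrincipalPrime

/-! ### Even and odd parts, and elimination of `t`. -/

section EvenOdd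

open Polynomial

variable {R : Type*} [CommRing R]

/-- The decomposition of a polynomial into its even and odd parts. -/
theorem exists_comp_sq_add (p : R[X]) :
    ∃ A B : R[X], p = A.comp (X ^ 2) + X * B.comp (X ^ 2) := by
  induction p using Polynomial.induction_on' with
  | add p q hp hq =>
    obtain ⟨A, B, rfl⟩ := hp
    obtain ⟨A', B', rfl⟩ := hq
    exact ⟨A + A', B + B', by simp only [add_comp]; ring⟩
  | monomial m a =>
    rcases Nat.even_or_odd' m with ⟨k, rfl | rfl⟩
    · exact ⟨C a * X ^ k, 0, by simp [← C_mul_X_pow_eq_monomial, pow_mul]⟩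
    · exact ⟨0, C a * X ^ k, by
        simp only [← C_mul_X_pow_eq_monomial, zero_comp, mul_comp, C_comp, pow_comp, X_comp,
          pow_succ, pow_mul]
        ring⟩

theorem eq_of_comp_sq_eq {A B D : R[X]}
    (h : A.comp (X ^ 2) = B.comp (X ^ 2) + X * D.comp (X ^ 2)) : A = B := by
  ext k
  have h1 := congrArg (fun p => coeff p (k * 2)) h
  simp only [← expand_eq_comp_X_pow, coeff_add, coeff_expand_mul two_pos] at h1
  rw [h1]
  cases k with
  | zero => simp
  | succ k =>
    rw [show (k + 1) * 2 = k * 2 + 1 + 1 by ring, coeff_X_mul, coeff_expand two_pos, if_neg (by omega),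
      add_zero]

end EvenOdd

section Elimination

variable {n s : ℕ} {f : Fin s → MvPolynomial (Fin n) ℂ}

/-- The polynomials in `T` over `ℂ[u, v]` that lie in the critical ideal once `T` is replaced by
the squared distance. -/
noncomputable def distanceIdeal (f : Fin s → MvPolynomial (Fin n) ℂ) :
    Ideal (Polynomial (PRing n)) :=
  (criticalIdeal f).comap (Polynomial.eval₂RingHom (inclUV n) (distPoly n))

theorem mem_distanceIdeal {A : Polynomial (PRing n)} :
    A ∈ distanceIdeal f ↔ A.eval₂ (inclUV n) (distPoly n) ∈ criticalIdeal f := Iff.rfl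

/-- The quotient `H[t] / (I, t² - q)` is free over `H / I` with basis `1, t`, and the class in
question is `A(q) + t B(q)`. -/
theorem comp_sq_add_mem_sup_iff {H : Type*} [CommRing H] (I : Ideal H) (q : H)
    (A B : Polynomial H) :
    A.comp (Polynomial.X ^ 2) + Polynomial.X * B.comp (Polynomial.X ^ 2) ∈
      I.map (Polynomial.C : H →+* Polynomial H) ⊔
        Ideal.span {Polynomial.X ^ 2 - Polynomial.C q} ↔ A.eval q ∈ I ∧ B.eval q ∈ I := by
  set J := I.map (Polynomial.C : H →+* Polynomial H) ⊔
    Ideal.span {Polynomial.X ^ 2 - Polynomial.C q} with hJ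
  have h1 : ∀ A : Polynomial H, A.comp (Polynomial.X ^ 2) - Polynomial.C (A.eval q) ∈ J := by
    intro A
    refine Ideal.mem_sup_right (Ideal.mem_span_singleton.2 ?_)
    have := Polynomial.sub_dvd_eval_sub (Polynomial.X ^ 2) (Polynomial.C q)
      (A.map Polynomial.C)
    rw [Polynomial.eval_map, Polynomial.eval_map, Polynomial.eval₂_at_apply] at this
    exact this
  have h2 : A.comp (Polynomial.X ^ 2) + Polynomial.X * B.comp (Polynomial.X ^ 2) ∈ J ↔
      Polynomial.C (A.eval q) + Polynomial.X * Polynomial.C (B.eval q) ∈ J := by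
    have h3 := J.add_mem (h1 A) (J.mul_mem_left Polynomial.X (h1 B))
    rw [← Ideal.add_mem_iff_right J h3 (b := Polynomial.C (A.eval q) + _)]
    ring_nf
  rw [h2]
  constructor
  · intro h
    let π := Ideal.Quotient.mk I
    have hle : J ≤ (Ideal.span {Polynomial.X ^ 2 - Polynomial.C (π q)}).comap
        (Polynomial.mapRingHom π) := by
      refine sup_le (Ideal.map_le_iff_le_comap.2 fun a ha => ?_)
        ((Ideal.span_singleton_le_iff_mem _).2 ?_)
      · rw [Ideal.mem_comap, Ideal.mem_comap, Polynomial.coe_mapRingHom, Polynomial.map_C,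
          Ideal.Quotient.eq_zero_iff_mem.2 ha, Polynomial.C_0]
        exact Ideal.zero_mem _
      · rw [Ideal.mem_comap]
        simp
    have h3 := hle h
    rw [Ideal.mem_comap, Ideal.mem_span_singleton] at h3
    by_cases hI : I = ⊤
    · simp [hI]
    have := Ideal.Quotient.nontrivial_iff.2 hI
    have hmonic : (Polynomial.X ^ 2 - Polynomial.C (π q)).Monic :=
      Polynomial.monic_X_pow_sub_C _ two_ne_zero
    have h4 : Polynomial.mapRingHom π
        (Polynomial.C (A.eval q) + Polynomial.X * Polynomial.C (B.eval q)) =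
        Polynomial.C (π (B.eval q)) * Polynomial.X + Polynomial.C (π (A.eval q)) := by
      simp
      ring
    rw [h4] at h3
    have h5 : Polynomial.C (π (B.eval q)) * Polynomial.X + Polynomial.C (π (A.eval q)) = 0 := by
      by_contra hne
      refine hmonic.not_dvd_of_degree_lt hne ?_ h3
      rw [Polynomial.degree_X_pow_sub_C two_pos]
      exact Polynomial.degree_linear_le.trans_lt (by norm_num)
    have h6 := congrArg (fun p => p.coeff 0) h5
    have h7 := congrArg (fun p => p.coeff 1) h5
    simp only [Polynomial.coeff_add, Polynomial.coeff_C_mul, Polynomial.coeff_X_zero, mul_zero,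
      Polynomial.coeff_C_zero, zero_add, Polynomial.coeff_zero, Polynomial.coeff_X_one, mul_one,
      Polynomial.coeff_C_succ, add_zero] at h6 h7
    exact ⟨Ideal.Quotient.eq_zero_iff_mem.1 h6, Ideal.Quotient.eq_zero_iff_mem.1 h7⟩
  · rintro ⟨hA, hB⟩
    exact J.add_mem (Ideal.mem_sup_left (Ideal.mem_map_of_mem _ hA))
      (J.mul_mem_left _ (Ideal.mem_sup_left (Ideal.mem_map_of_mem _ hB)))

theorem comp_sq_add_mem_eliminationIdeal {A B : Polynomial (PRing n)} :
    A.comp (Polynomial.X ^ 2) + Polynomial.X * B.comp (Polynomial.X ^ 2) ∈ eliminationIdeal f ↔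
      A ∈ distanceIdeal f ∧ B ∈ distanceIdeal f := by
  rw [eliminationIdeal, Ideal.mem_comap, Polynomial.coe_mapRingHom, Polynomial.map_add,
    Polynomial.map_mul, Polynomial.map_comp, Polynomial.map_comp, Polynomial.map_pow,
    Polynomial.map_X, comp_sq_add_mem_sup_iff, Polynomial.eval_map, Polynomial.eval_map]
  rfl

theorem comp_sq_mem_eliminationIdeal {A : Polynomial (PRing n)} :
    A.comp (Polynomial.X ^ 2) ∈ eliminationIdeal f ↔ A ∈ distanceIdeal f := by
  have := comp_sq_add_mem_eliminationIdeal (f := f) (A := A) (B := 0)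
  simpa using this

/-- Even and odd parts lie in the elimination ideal independently, so generation by `P(t²)` amounts
to generation of the ideal in `T = t²` by `P`. -/
theorem isVHDPolynomial_iff {P : Polynomial (PRing n)} :
    IsVHDPolynomial f P ↔ distanceIdeal f = Ideal.span {P} := by
  constructor
  · intro h
    refine le_antisymm (fun A hA => ?_) ((Ideal.span_singleton_le_iff_mem _).2 ?_)
    · rw [← comp_sq_mem_eliminationIdeal, h, Ideal.mem_span_singleton] at hA
      obtain ⟨r, hr⟩ := hA
      obtain ⟨B, D, rfl⟩ := exists_comp_sq_add r
      refine Ideal.mem_span_singleton.2 ⟨B, eq_of_comp_sq_eq (D := P * D) ?_⟩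
      rw [hr, Polynomial.mul_comp, Polynomial.mul_comp]
      ring
    · rw [← comp_sq_mem_eliminationIdeal, h]
      exact Ideal.mem_span_singleton_self _
  · intro h
    ext p
    rw [Ideal.mem_span_singleton]
    constructor
    · intro hp
      obtain ⟨A, B, rfl⟩ := exists_comp_sq_add p
      rw [comp_sq_add_mem_eliminationIdeal, h, Ideal.mem_span_singleton,
        Ideal.mem_span_singleton] at hp
      obtain ⟨⟨A', rfl⟩, B', rfl⟩ := hp
      refine ⟨A'.comp (Polynomial.X ^ 2) + Polynomial.X * B'.comp (Polynomial.X ^ 2), ?_⟩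
      rw [Polynomial.mul_comp, Polynomial.mul_comp]
      ring
    · rintro ⟨r, rfl⟩
      refine Ideal.mul_mem_right _ _ (comp_sq_mem_eliminationIdeal.2 ?_)
      rw [h]
      exact Ideal.mem_span_singleton_self _

end Elimination

end HermitianDistance

namespace HermitianDistance

open MvPolynomial

/-! ### Existence of the virtual Hermitian distance polynomial. -/

section Existence

variable {n s : ℕ} {f : Fin s → MvPolynomial (Fin n) ℂ}

theorem isPrime_criticalIdeal (hprime : (ideal f).IsPrime) : (criticalIdeal f).IsPrime := by
  have := isPrime_conormalPairsVanishing f hprime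
  rw [criticalIdeal_eq hprime]
  exact Ideal.comap_isPrime _ _

theorem isPrime_distanceIdeal (hprime : (ideal f).IsPrime) : (distanceIdeal f).IsPrime := by
  have := isPrime_criticalIdeal hprime
  exact Ideal.comap_isPrime _ _

theorem trdeg_conormalPairs_le (hprime : (ideal f).IsPrime) :
    Algebra.trdeg ℂ (MvPolynomial ((Fin n ⊕ Fin n) ⊕ (Fin n ⊕ Fin n)) ℂ ⧸
      conormalPairsVanishing f) ≤ n + n := by
  have hprime' := isPrime_ideal_conjFamily f hprime
  have := isPrime_conormalPairsVanishing f hprime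
  have := isPrime_conormalVanishing hprime
  have := isPrime_conormalVanishing hprime'
  let π := Ideal.Quotient.mkₐ ℂ (conormalPairsVanishing f)
  have hπ : ∀ p, π p = 0 ↔ p ∈ conormalPairsVanishing f :=
    fun p => Ideal.Quotient.eq_zero_iff_mem
  let φ : (MvPolynomial (Fin n ⊕ Fin n) ℂ ⧸ conormalVanishing f) →ₐ[ℂ]
      (MvPolynomial ((Fin n ⊕ Fin n) ⊕ (Fin n ⊕ Fin n)) ℂ ⧸ conormalPairsVanishing f) :=
    Ideal.Quotient.liftₐ _ (π.comp inclLeft) fun p hp =>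
      (hπ _).2 ((inclLeft_mem_conormalPairsVanishing hprime).2 hp)
  let φ' : (MvPolynomial (Fin n ⊕ Fin n) ℂ ⧸ conormalVanishing (conjFamily f)) →ₐ[ℂ]
      (MvPolynomial ((Fin n ⊕ Fin n) ⊕ (Fin n ⊕ Fin n)) ℂ ⧸ conormalPairsVanishing f) :=
    Ideal.Quotient.liftₐ _ (π.comp inclRight) fun p hp =>
      (hπ _).2 ((inclRight_mem_conormalPairsVanishing hprime).2 hp)
  have hφm : ∀ p, φ (Ideal.Quotient.mk _ p) = π (inclLeft p) := fun p => rfl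
  have hφm' : ∀ p, φ' (Ideal.Quotient.mk _ p) = π (inclRight p) := fun p => rfl
  refine (trdeg_le_add φ φ' ?_ ?_ ?_).trans_eq
    (congrArg₂ (· + ·) (trdeg_conormal hprime) (trdeg_conormal hprime'))
  · rw [injective_iff_map_eq_zero]
    intro x hx
    obtain ⟨p, rfl⟩ := Ideal.Quotient.mk_surjective x
    rw [hφm, hπ, inclLeft_mem_conormalPairsVanishing hprime] at hx
    exact Ideal.Quotient.eq_zero_iff_mem.2 hx
  · rw [injective_iff_map_eq_zero]
    intro x hx
    obtain ⟨p, rfl⟩ := Ideal.Quotient.mk_surjective x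
    rw [hφm', hπ, inclRight_mem_conormalPairsVanishing hprime] at hx
    exact Ideal.Quotient.eq_zero_iff_mem.2 hx
  · rw [eq_top_iff]
    rintro x -
    obtain ⟨p, rfl⟩ := Ideal.Quotient.mk_surjective x
    change π p ∈ _
    induction p using MvPolynomial.induction_on with
    | C a => exact Subalgebra.algebraMap_mem _ a
    | add p q hp hq => rw [map_add]; exact Subalgebra.add_mem _ hp hq
    | mul_X p i hp =>
      rw [map_mul]
      refine Subalgebra.mul_mem _ hp (Algebra.subset_adjoin ?_)
      rcases i with i | i
      · exact Or.inl ⟨Ideal.Quotient.mk _ (X i), by rw [hφm]; simp [inclLeft]⟩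
      · exact Or.inr ⟨Ideal.Quotient.mk _ (X i), by rw [hφm']; simp [inclRight]⟩

/-- Otherwise the `2n` data coordinates and the squared distance would be `2n + 1` algebraically
independent elements of a ring of transcendence degree at most `2n`. -/
theorem distanceIdeal_ne_bot (hprime : (ideal f).IsPrime) : distanceIdeal f ≠ ⊥ := by
  intro hbot
  have := isPrime_conormalPairsVanishing f hprime
  let π := Ideal.Quotient.mkₐ ℂ (conormalPairsVanishing f)
  let φ : HRing n →ₐ[ℂ] (MvPolynomial ((Fin n ⊕ Fin n) ⊕ (Fin n ⊕ Fin n)) ℂ ⧸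
    conormalPairsVanishing f) := π.comp (toConormalPairs n)
  have hφ : ∀ p, φ p = 0 → p ∈ criticalIdeal f := fun p hp => by
    rw [criticalIdeal_eq hprime]
    exact Ideal.mem_comap.2 (Ideal.Quotient.eq_zero_iff_mem.1 hp)
  let x : Option (Fin n ⊕ Fin n) → HRing n :=
    fun o => o.elim (distPoly n) fun i => inclUV n (X i)
  have hx : ∀ p, aeval x p =
      (optionEquivLeft ℂ (Fin n ⊕ Fin n) p).eval₂ (inclUV n) (distPoly n) := by
    intro p
    induction p using MvPolynomial.induction_on with
    | C a => simp [inclUV]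
    | add p q hp hq => rw [map_add, map_add, Polynomial.eval₂_add, hp, hq]
    | mul_X p i hp =>
      rw [map_mul, map_mul, Polynomial.eval₂_mul, hp, aeval_X]
      cases i <;> simp [x]
  have hind : AlgebraicIndependent ℂ fun o => φ (x o) := by
    rw [algebraicIndependent_iff]
    intro p hp
    have h1 : φ (aeval x p) = 0 := by
      rw [← hp]
      exact DFunLike.congr_fun (comp_aeval x φ) p
    have h2 : optionEquivLeft ℂ (Fin n ⊕ Fin n) p ∈ distanceIdeal f := by
      rw [mem_distanceIdeal, ← hx]
      exact hφ _ h1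
    rw [hbot, Ideal.mem_bot] at h2
    exact (map_eq_zero_iff _ (optionEquivLeft ℂ (Fin n ⊕ Fin n)).injective).1 h2
  have h1 := hind.cardinalMk_le_trdeg.trans (trdeg_conormalPairs_le hprime)
  rw [Cardinal.mk_fintype] at h1
  have h2 : Fintype.card (Option (Fin n ⊕ Fin n)) ≤ n + n := by exact_mod_cast h1
  simp at h2

theorem exists_isVHDPolynomial (hprime : (ideal f).IsPrime) :
    ∃ P : Polynomial (PRing n), P ≠ 0 ∧ IsVHDPolynomial f P := by
  obtain ⟨P, hP⟩ := exists_span_singleton_of_isPrime (isPrime_distanceIdeal hprime) fun h hh => by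
    rw [mem_distanceIdeal, Polynomial.eval₂_C] at hh
    exact eq_zero_of_inclUV_mem_criticalIdeal hprime hh
  refine ⟨P, ?_, isVHDPolynomial_iff.2 hP⟩
  rintro rfl
  rw [Ideal.span_singleton_zero] at hP
  exact distanceIdeal_ne_bot hprime hP

end Existence

end HermitianDistance

namespace HermitianDistance

open MvPolynomial

/-! ### Comparison of the distance ideals of a cone and of its dual. -/

section Duality

variable {n s r : ℕ} {f : Fin s → MvPolynomial (Fin n) ℂ} {g : Fin r → MvPolynomial (Fin n) ℂ}

/-- Biduality identifies vanishing ideals of conormal sets, not the sets themselves. Slicing in one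
variable at a time shows that this is enough for products. -/
theorem vanishingIdeal_prodSet_congr {σ τ : Type*} {V V' : Set (σ → ℂ)} {W W' : Set (τ → ℂ)}
    (hV : vanishingIdeal ℂ V = vanishingIdeal ℂ V') (hW : vanishingIdeal ℂ W = vanishingIdeal ℂ W') :
    vanishingIdeal ℂ (prodSet V W) = vanishingIdeal ℂ (prodSet V' W') := by
  ext p
  have h1 : ∀ y, (∀ x ∈ V, aeval (Sum.elim x y) p = 0) ↔
      ∀ x ∈ V', aeval (Sum.elim x y) p = 0 := fun y => by
    have := Ideal.ext_iff.1 hV (specRight y p)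
    simpa only [mem_vanishingIdeal_iff, aeval_specRight] using this
  have h2 : ∀ x, (∀ y ∈ W, aeval (Sum.elim x y) p = 0) ↔
      ∀ y ∈ W', aeval (Sum.elim x y) p = 0 := fun x => by
    have := Ideal.ext_iff.1 hW (specLeft x p)
    simpa only [mem_vanishingIdeal_iff, aeval_specLeft] using this
  rw [mem_vanishingIdeal_prodSet, mem_vanishingIdeal_prodSet]
  simp only [h2]
  exact ⟨fun h x hx y hy => (h1 y).1 (fun x hx => h x hx y hy) x hx,
    fun h x hx y hy => (h1 y).2 (fun x hx => h x hx y hy) x hx⟩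

theorem vanishingIdeal_swap (V : Set (Fin n ⊕ Fin n → ℂ)) :
    vanishingIdeal ℂ {x | x ∘ Sum.swap ∈ V} =
      Ideal.comap (rename Sum.swap : _ →ₐ[ℂ] MvPolynomial (Fin n ⊕ Fin n) ℂ)
        (vanishingIdeal ℂ V) := by
  ext p
  rw [Ideal.mem_comap, mem_vanishingIdeal_iff, mem_vanishingIdeal_iff]
  simp only [aeval_rename, Set.mem_ofPred_eq]
  refine ⟨fun h x hx => h _ ?_, fun h x hx => ?_⟩
  · rwa [Function.comp_assoc, Sum.swap_swap_eq, Function.comp_id]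
  · have := h _ hx
    rwa [Function.comp_assoc, Sum.swap_swap_eq, Function.comp_id] at this

theorem conormalVanishing_conjFamily_dual
    (h : conormalVanishing g = Ideal.comap (rename Sum.swap) (conormalVanishing f)) :
    conormalVanishing (conjFamily g) =
      Ideal.comap (rename Sum.swap) (conormalVanishing (conjFamily f)) := by
  ext p
  rw [Ideal.mem_comap, mem_conormalVanishing_conjFamily, mem_conormalVanishing_conjFamily, h,
    Ideal.mem_comap]
  rw [conjCoeff, map_rename]

theorem aeval_hermitianPoint_eval₂ (z y w x : Fin n → ℂ) (A : Polynomial (PRing n)) :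
    aeval (hermitianPoint z y w x) (A.eval₂ (inclUV n) (distPoly n)) =
      (A.map (aeval (Sum.elim (z + x) (w + y)) : PRing n →ₐ[ℂ] ℂ).toRingHom).eval (x ⬝ᵥ y) := by
  have h1 : (aeval (hermitianPoint z y w x) : HRing n →ₐ[ℂ] ℂ).toRingHom.comp (inclUV n) =
      (aeval (Sum.elim (z + x) (w + y)) : PRing n →ₐ[ℂ] ℂ).toRingHom := by
    refine ringHom_ext (fun a => by simp [inclUV]) fun i => ?_
    cases i <;> simp [inclUV, hermitianPoint]
  have h2 : (aeval (hermitianPoint z y w x) : HRing n →ₐ[ℂ] ℂ).toRingHom (distPoly n) =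
      x ⬝ᵥ y := by
    simp [distPoly, hermitianPoint, dotProduct]
  rw [Polynomial.eval_map, ← h1, ← h2, ← Polynomial.hom_eval₂]
  rfl

/-- Membership in the distance ideal, tested on pairs of conormal vectors. -/
theorem mem_distanceIdeal_iff (hprime : (ideal f).IsPrime) {A : Polynomial (PRing n)} :
    A ∈ distanceIdeal f ↔ ∀ z y, Sum.elim z y ∈ conormalSet f →
      ∀ w x, Sum.elim w x ∈ conormalSet (conjFamily f) →
        (A.map (aeval (Sum.elim (z + x) (w + y)) : PRing n →ₐ[ℂ] ℂ).toRingHom).eval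
          (x ⬝ᵥ y) = 0 := by
  rw [mem_distanceIdeal, mem_criticalIdeal hprime]
  simp only [aeval_hermitianPoint_eval₂]

theorem dotProduct_eq_zero_of_mem_conormalSet (hprime : (ideal f).IsPrime)
    (hcone : ∀ (a : ℂ), ∀ z ∈ variety f, a • z ∈ variety f) {z y : Fin n → ℂ}
    (h : Sum.elim z y ∈ conormalSet f) : z ⬝ᵥ y = 0 := by
  obtain ⟨z', hz, ℓ, h1⟩ := h
  obtain ⟨rfl, rfl⟩ := Sum.elim_eq_iff.1 h1
  exact dotProduct_vecMul_jacobian_eq_zero hprime hcone (fun _ hp => (mem_ideal_iff hprime).1 hp _ hz) ℓ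

/-- The substitution that exchanges the distance to a cone with the distance to its dual. -/
noncomputable def dualSubst (A : Polynomial (PRing n)) : Polynomial (PRing n) :=
  (A.map (swapUV n)).comp (Polynomial.C (pairing n) - Polynomial.X)

theorem dualSubst_mul (A B : Polynomial (PRing n)) :
    dualSubst (A * B) = dualSubst A * dualSubst B := by
  rw [dualSubst, Polynomial.map_mul, Polynomial.mul_comp]
  rfl

theorem swapUV_swapUV (p : PRing n) : swapUV n (swapUV n p) = p := by
  change rename Sum.swap (rename Sum.swap p) = p
  rw [rename_rename, Sum.swap_swap_eq, rename_id, AlgHom.id_apply]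

theorem swapUV_pairing : swapUV n (pairing n) = pairing n := by
  simp [swapUV, pairing, mul_comm]

theorem dualSubst_dualSubst (A : Polynomial (PRing n)) : dualSubst (dualSubst A) = A := by
  have h : (swapUV n).comp (swapUV n) = RingHom.id _ := RingHom.ext swapUV_swapUV
  rw [dualSubst, dualSubst, Polynomial.map_comp, Polynomial.map_map, h, Polynomial.map_id,
    Polynomial.comp_assoc]
  simp [swapUV_pairing]

/-- Both memberships are tested on the same pairs of conormal vectors of `X` and its conjugate, and
there the two conditions coincide. -/
theorem dualSubst_mem_distanceIdeal (hprime : (ideal f).IsPrime)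
    (hcone : ∀ (a : ℂ), ∀ z ∈ variety f, a • z ∈ variety f)
    (hg : ideal g = vanishingIdeal ℂ (dualVariety f)) {A : Polynomial (PRing n)} :
    dualSubst A ∈ distanceIdeal f ↔ A ∈ distanceIdeal g := by
  have hprime' := isPrime_ideal_conjFamily f hprime
  have hgprime := isPrime_ideal_dual hprime hg
  have h1 := conormalVanishing_dual hprime hcone hg
  have h2 := conormalVanishing_conjFamily_dual h1
  have h3 : conormalPairsVanishing g = vanishingIdeal ℂ
      (prodSet {x | x ∘ Sum.swap ∈ conormalSet f}
        {x | x ∘ Sum.swap ∈ conormalSet (conjFamily f)}) :=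
    vanishingIdeal_prodSet_congr (h1.trans (vanishingIdeal_swap _).symm)
      (h2.trans (vanishingIdeal_swap _).symm)
  -- For the dual the roles `z ↔ y` and `w ↔ x` are exchanged, so its data point is `(y + w, x + z)
  -- = (v, u)` and its squared distance is `⟨w, z⟩`.
  have h4 : A ∈ distanceIdeal g ↔ ∀ z y, Sum.elim z y ∈ conormalSet f →
      ∀ w x, Sum.elim w x ∈ conormalSet (conjFamily f) →
        (A.map (aeval (Sum.elim (y + w) (x + z)) : PRing n →ₐ[ℂ] ℂ).toRingHom).eval
          (w ⬝ᵥ z) = 0 := by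
    rw [mem_distanceIdeal, criticalIdeal_eq hgprime, Ideal.mem_comap, h3,
      mem_vanishingIdeal_prodSet]
    constructor
    · intro H z y hzy w x hwx
      rw [← aeval_hermitianPoint_eval₂, ← aeval_toConormalPairs]
      refine H _ ?_ _ ?_
      · rw [Set.mem_ofPred_eq, Sum.elim_swap]
        exact hzy
      · rw [Set.mem_ofPred_eq, Sum.elim_swap]
        exact hwx
    · intro H p hp q hq
      rw [← Sum.elim_comp_inl_inr p, Set.mem_ofPred_eq, Sum.elim_swap] at hp
      rw [← Sum.elim_comp_inl_inr q, Set.mem_ofPred_eq, Sum.elim_swap] at hq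
      rw [← Sum.elim_comp_inl_inr p, ← Sum.elim_comp_inl_inr q, aeval_toConormalPairs,
        aeval_hermitianPoint_eval₂]
      exact H _ _ hp _ _ hq
  rw [mem_distanceIdeal_iff hprime, h4]
  refine forall₂_congr fun z y => forall_congr' fun hzy => forall₂_congr fun w x =>
    forall_congr' fun hwx => ?_
  have e1 : z ⬝ᵥ y = 0 := dotProduct_eq_zero_of_mem_conormalSet hprime hcone hzy
  have e2 : w ⬝ᵥ x = 0 :=
    dotProduct_eq_zero_of_mem_conormalSet hprime' (cone_conjFamily hcone) hwx
  have e3 : (aeval (Sum.elim (z + x) (w + y)) : PRing n →ₐ[ℂ] ℂ).toRingHom.comp (swapUV n) =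
      (aeval (Sum.elim (y + w) (x + z)) : PRing n →ₐ[ℂ] ℂ).toRingHom := by
    refine ringHom_ext (fun a => by simp [swapUV]) fun i => ?_
    cases i <;> simp [swapUV, add_comm]
  have e4 : (aeval (Sum.elim (z + x) (w + y)) : PRing n →ₐ[ℂ] ℂ).toRingHom (pairing n) =
      (z + x) ⬝ᵥ (w + y) := by
    simp [pairing, dotProduct]
  -- The Pythagorean identity: the cross terms `⟨z, y⟩` and `⟨x, w⟩` vanish because `X` and its
  -- conjugate are cones.
  have e5 : (z + x) ⬝ᵥ (w + y) - x ⬝ᵥ y = w ⬝ᵥ z := by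
    rw [add_dotProduct, dotProduct_add, dotProduct_add, e1, dotProduct_comm x w, e2,
      dotProduct_comm z w]
    ring
  rw [dualSubst, Polynomial.map_comp, Polynomial.map_map, e3, Polynomial.eval_comp,
    Polynomial.map_sub, Polynomial.map_C, Polynomial.map_X, Polynomial.eval_sub,
    Polynomial.eval_C, Polynomial.eval_X, e4, e5]

/-- Generators of the two distance ideals correspond to each other up to a constant. -/
theorem exists_eq_C_mul_dualSubst (hprime : (ideal f).IsPrime)
    (hcone : ∀ (a : ℂ), ∀ z ∈ variety f, a • z ∈ variety f)
    (hg : ideal g = vanishingIdeal ℂ (dualVariety f)) {P Q : Polynomial (PRing n)}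
    (hP : distanceIdeal f = Ideal.span {P}) (hQ : distanceIdeal g = Ideal.span {Q}) :
    ∃ a : ℂ, a ≠ 0 ∧ P = Polynomial.C (C a) * dualSubst Q := by
  have h1 : P ∣ dualSubst Q := by
    rw [← Ideal.mem_span_singleton, ← hP, dualSubst_mem_distanceIdeal hprime hcone hg, hQ]
    exact Ideal.mem_span_singleton_self Q
  have h2 : dualSubst Q ∣ P := by
    have : Q ∣ dualSubst P := by
      rw [← Ideal.mem_span_singleton, ← hQ, ← dualSubst_mem_distanceIdeal hprime hcone hg,
        dualSubst_dualSubst, hP]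
      exact Ideal.mem_span_singleton_self P
    obtain ⟨B, hB⟩ := this
    exact ⟨dualSubst B, by rw [← dualSubst_mul, ← hB, dualSubst_dualSubst]⟩
  obtain ⟨u, hu⟩ := associated_of_dvd_dvd h2 h1
  -- Units of `ℂ[u, v][T]` are nonzero complex constants.
  obtain ⟨p, hp, hpu⟩ := Polynomial.isUnit_iff.1 u.isUnit
  obtain ⟨a, ha, hap⟩ := MvPolynomial.isUnit_iff_eq_C_of_isReduced.1 hp
  refine ⟨a, ha.ne_zero, ?_⟩
  rw [← hu, ← hpu, hap, mul_comm]

end Duality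

end HermitianDistance

theorem mainTheorem11 {n s r : ℕ}
    (f : Fin s → MvPolynomial (Fin n) ℂ)
    (hprime : (HermitianDistance.ideal f).IsPrime)
    (hcone : ∀ (a : ℂ), ∀ z ∈ HermitianDistance.variety f, a • z ∈ HermitianDistance.variety f)
    (g : Fin r → MvPolynomial (Fin n) ℂ)
    (hg : HermitianDistance.ideal g =
      MvPolynomial.vanishingIdeal ℂ (HermitianDistance.dualVariety f)) :
    (∃ P : Polynomial (HermitianDistance.PRing n),
      P ≠ 0 ∧ HermitianDistance.IsVHDPolynomial f P) ∧
    (∃ Q : Polynomial (HermitianDistance.PRing n),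
      Q ≠ 0 ∧ HermitianDistance.IsVHDPolynomial g Q) ∧
    ∀ P Q : Polynomial (HermitianDistance.PRing n),
      HermitianDistance.IsVHDPolynomial f P → HermitianDistance.IsVHDPolynomial g Q →
      ∃ a : ℂ, a ≠ 0 ∧
        P.comp (Polynomial.X ^ 2) =
          Polynomial.C (MvPolynomial.C a) *
            (Q.map (HermitianDistance.swapUV n)).comp
              (Polynomial.C (HermitianDistance.pairing n) - Polynomial.X ^ 2) := by
  refine ⟨HermitianDistance.exists_isVHDPolynomial hprime,
    HermitianDistance.exists_isVHDPolynomial (HermitianDistance.isPrime_ideal_dual hprime hg),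
    fun P Q hP hQ => ?_⟩
  obtain ⟨a, ha, h⟩ := HermitianDistance.exists_eq_C_mul_dualSubst hprime hcone hg
    (HermitianDistance.isVHDPolynomial_iff.1 hP) (HermitianDistance.isVHDPolynomial_iff.1 hQ)
  refine ⟨a, ha, ?_⟩
  rw [h, Polynomial.mul_comp, Polynomial.C_comp, HermitianDistance.dualSubst,
    Polynomial.comp_assoc, Polynomial.sub_comp, Polynomial.C_comp, Polynomial.X_comp]
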